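/- Let $\mathbb K$ be $\mathbb R$ or $\mathbb C$, and let $p,q$ be positive integers with $\gcd(p,q)=1$. For $n\ge 2$ consider the system $$\dot x=px+P(x,y),\qquad \dot y=-qy+Q(x,y),$$ where $P,Q$ are homogeneous polynomials of degree $n$ whose $2(n+1)$ coefficients are regarded as indeterminates, and let $R$ be the ring of polynomials over $\mathbb K$ in these coefficients. Saddle values of the system are elements $L_1,L_2,\dots\in R$ for which there is a formal power series $H=x^qy^p+\text{h.o.t.}$ with coefficients in $R$ whose derivative along the system is $\dot H=\sum_{k\ge1}L_k\,(x^qy^p)^{k+1}$. Let $I_k=(L_1,\dots,L_k)$ and $I_\infty=(L_1,L_2,\dots)$ in $R$, and let $M_h^I(p,q,n)$ be the least $M$ with $I_M=I_\infty$. Put $d=\gcd(n-1,p+q)$. Then there are constants $C$ and $n_0$ (depending only on $p,q$ and $\mathbb K$) such that for every $n\ge n_0$: saddle values exist, and for every choice of them, $I_M=I_\infty$ holds for $M=M_h^I(p,q,n)$, this $M$ is the largest $k\ge1$ with $L_k\notin I_{k-1}$, and $$M_h^I(p,q,n)\ \ge\ \frac{3}{2d}\,n^2-Cn .$$ If moreover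 $p=1$, then $$M_h^I(1,q,n)\ \ge\ \frac{2}{d}\,n^2-Cn .$$ -/

import Mathlib

namespace ResonantSaddle

/-- The indeterminate coefficients of the two homogeneous polynomials `P` and `Q` of degree `n` in
two variables: `Sum.inl i` is the coefficient of `x ^ (n - i) * y ^ i` in `P`, and `Sum.inr i` is
the coefficient of `x ^ (n - i) * y ^ i` in `Q`. -/
abbrev CoeffIndex (n : ℕ) : Type := Fin (n + 1) ⊕ Fin (n + 1)

/-- The ring of all polynomials, over the field `𝕜`, in the coefficients of `P` and `Q`. -/
abbrev CoeffRing (𝕜 : Type*) [Field 𝕜] (n : ℕ) : Type _ := MvPolynomial (CoeffIndex n) 𝕜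

section

variable {R : Type*} [CommRing R]

/-- The formal variable `x`. -/
noncomputable def x : MvPowerSeries (Fin 2) R := MvPowerSeries.X 0

/-- The formal variable `y`. -/
noncomputable def y : MvPowerSeries (Fin 2) R := MvPowerSeries.X 1

/-- The homogeneous form `∑ i, a i * x ^ (n - i) * y ^ i` of degree `n`. -/
noncomputable def form (n : ℕ) (a : Fin (n + 1) → R) : MvPowerSeries (Fin 2) R :=
  ∑ i : Fin (n + 1), MvPowerSeries.C (a i) * x ^ (n - (i : ℕ)) * y ^ (i : ℕ)

/-- The derivative `(p x + P) ∂H/∂x + (-q y + Q) ∂H/∂y` of the formal power series `H` along the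
vector field of the system `x' = p x + P`, `y' = -q y + Q`. -/
noncomputable def derivAlong (p q : ℕ) (P Q H : MvPowerSeries (Fin 2) R) :
    MvPowerSeries (Fin 2) R :=
  ((p : MvPowerSeries (Fin 2) R) * x + P) * MvPowerSeries.pderiv R 0 H +
    (-((q : MvPowerSeries (Fin 2) R) * y) + Q) * MvPowerSeries.pderiv R 1 H

/-- The exponent of the monomial `(x ^ q * y ^ p) ^ k`. -/
noncomputable def resonantExp (p q k : ℕ) : Fin 2 →₀ ℕ :=
  Finsupp.single 0 (k * q) + Finsupp.single 1 (k * p)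

/-- `H = x ^ q * y ^ p + h.o.t.`, the remaining terms having total degree greater than `p + q`. -/
def HasResonantLeadingTerm (p q : ℕ) (H : MvPowerSeries (Fin 2) R) : Prop :=
  MvPowerSeries.coeff (resonantExp p q 1) H = 1 ∧
    ∀ m : Fin 2 →₀ ℕ, m.degree ≤ p + q → m ≠ resonantExp p q 1 → MvPowerSeries.coeff m H = 0

/-- The formal power series `F` is equal to `∑_{k ≥ 1} L k * (x ^ q * y ^ p) ^ (k + 1)`. -/
def IsResonantSeries (p q : ℕ) (L : ℕ → R) (F : MvPowerSeries (Fin 2) R) : Prop :=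
  (∀ k : ℕ, 1 ≤ k → MvPowerSeries.coeff (resonantExp p q (k + 1)) F = L k) ∧
    ∀ m : Fin 2 →₀ ℕ, (∀ k : ℕ, 1 ≤ k → m ≠ resonantExp p q (k + 1)) →
      MvPowerSeries.coeff m F = 0

/-- The ideal generated by `L 1, …, L k`. -/
def saddleIdeal (L : ℕ → R) (k : ℕ) : Ideal R := Ideal.span (L '' Set.Icc 1 k)

/-- The ideal generated by all the `L k`, `k ≥ 1`. -/
def saddleIdealTop (L : ℕ → R) : Ideal R := Ideal.span (L '' Set.Ici 1)

/-- The least `M` such that `L 1, …, L M` generate the ideal generated by all the `L k`, `k ≥ 1`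
(such an `M` exists whenever `R` is Noetherian). -/
noncomputable def idealOrder (L : ℕ → R) : ℕ :=
  sInf {M : ℕ | saddleIdeal L M = saddleIdealTop L}

end

/-- `L 1, L 2, …` (the value `L 0` is irrelevant) are saddle values of the `p : -q` resonant system
`x' = p x + P(x, y)`, `y' = -q y + Q(x, y)`, where `P` and `Q` are the homogeneous polynomials of
degree `n` with indeterminate coefficients: there is a formal power series
`H = x ^ q * y ^ p + h.o.t.`, whose coefficients are polynomials in those of `P` and `Q`, with
derivative `∑_{k ≥ 1} L k * (x ^ q * y ^ p) ^ (k + 1)` along the system. -/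
def IsSaddleValues (𝕜 : Type*) [Field 𝕜] (p q n : ℕ) (L : ℕ → CoeffRing 𝕜 n) : Prop :=
  ∃ H : MvPowerSeries (Fin 2) (CoeffRing 𝕜 n),
    HasResonantLeadingTerm p q H ∧
      IsResonantSeries p q L
        (derivAlong p q (form n fun i => MvPolynomial.X (Sum.inl i))
          (form n fun i => MvPolynomial.X (Sum.inr i)) H)

end ResonantSaddle

/-! Saddle values are polynomials, so a ring homomorphism from `CoeffRing` that kills `L 1, …, L
(k-1)` but not `L k` shows that `L k` is not in the ideal of the preceding ones, whence `k ≤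
idealOrder L`. The homomorphism used takes values in the dual numbers: it describes a first-order
perturbation of a system with an explicit first integral.

Let `X_Φ` be the Hamiltonian field of `q log x + p log y + Φ` in logarithmic variables. It preserves
`I = x^q y^p exp Φ` and has no divergence. Add `ε W x ∂/∂x` with `ε² = 0`. Pairing the derivative of
`H` with `I^{-N}` and taking residues removes the `X_Φ`-part (`coeff_expSeries_mul_hamField`). Since
`εH` is a series in `I`, integration by parts leaves only the Melnikov numbers, the coefficients of
`(x^q y^p)^κ` in `x W_x exp(-κΦ)`. The first nonzero one gives the first nonzero saddle value
(`saddleValue_of_perturbation`).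

Let `Φ` be the sum of the monomials with exponents `u = (r, l+e+1)` and `v = (l+r, e+1)`, where `p r
= q(e+1) + 1`, and let `W` combine those with exponents `u + (1,-1)` and `v + (1,-1)`. Then `Φ` and
`W` have degrees making the system homogeneous of degree `n = l+r+e+2`. The number with index `κ`
can be nonzero only if `a u + b v + (1,-1) = κ (q,p)` for some naturals `a, b`. These indices are
sparse: `κ = (n-1)(t l - d)/d` with `t ≥ 1` (`parameter_of_resonance`). The two coefficients of `W`
are chosen to cancel the number at `t = 1`; the one at `t = 2` then survives, so `k =
(n-1)(2l-d)/d`. As `n - l` is constant, this is `2n²/d - O(n)`. -/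

namespace ResonantSaddle

open MvPowerSeries

/-! ### Exponents, logarithmic derivations and orders. -/

/-- The exponent of the monomial `x ^ i * y ^ j`. -/
noncomputable def bideg (i j : ℕ) : Fin 2 →₀ ℕ := Finsupp.single 0 i + Finsupp.single 1 j

@[simp] theorem bideg_zero_apply (i j : ℕ) : bideg i j 0 = i := by simp [bideg]

@[simp] theorem bideg_one_apply (i j : ℕ) : bideg i j 1 = j := by simp [bideg]

theorem exponent_ext {e f : Fin 2 →₀ ℕ} (h0 : e 0 = f 0) (h1 : e 1 = f 1) : e = f := by
  ext i
  fin_cases i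
  · exact h0
  · exact h1

theorem degree_eq_add (e : Fin 2 →₀ ℕ) : e.degree = e 0 + e 1 := by
  rw [Finsupp.degree_eq_sum, Fin.sum_univ_two]

@[simp] theorem degree_bideg (i j : ℕ) : (bideg i j).degree = i + j := by simp [degree_eq_add]

theorem resonantExp_eq (p q k : ℕ) : resonantExp p q k = bideg (k * q) (k * p) := rfl

@[simp] theorem resonantExp_zero_apply (p q k : ℕ) : resonantExp p q k 0 = k * q := by
  simp [resonantExp_eq]

@[simp] theorem resonantExp_one_apply (p q k : ℕ) : resonantExp p q k 1 = k * p := by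
  simp [resonantExp_eq]

@[simp] theorem degree_resonantExp (p q k : ℕ) : (resonantExp p q k).degree = k * (p + q) := by
  simp [degree_eq_add]; ring

theorem exists_eq_resonantExp {p q : ℕ} (hp : 0 < p) (hpq : Nat.Coprime p q) {e : Fin 2 →₀ ℕ}
    (h : p * e 0 = q * e 1) : ∃ k, e = resonantExp p q k := by
  obtain ⟨k, hk⟩ : p ∣ e 1 := hpq.dvd_of_dvd_mul_left (h ▸ Dvd.intro _ rfl)
  refine ⟨k, exponent_ext ?_ (by rw [hk]; simp [mul_comm])⟩
  rw [hk] at h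
  have : p * e 0 = p * (k * q) := by rw [h]; ring
  simpa using Nat.eq_of_mul_eq_mul_left hp this

variable {S : Type*} [CommRing S]

theorem x_pow_mul_y_pow (i j : ℕ) :
    (x ^ i * y ^ j : MvPowerSeries (Fin 2) S) = monomial (bideg i j) 1 := by
  rw [x, y, X_pow_eq, X_pow_eq, monomial_mul_monomial, one_mul, bideg]

/-- The logarithmic derivation `X i * ∂/∂(X i)`. -/
noncomputable def logDeriv (i : Fin 2) :
    Derivation S (MvPowerSeries (Fin 2) S) (MvPowerSeries (Fin 2) S) :=
  (X i : MvPowerSeries (Fin 2) S) • pderiv S i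

theorem logDeriv_apply (i : Fin 2) (F : MvPowerSeries (Fin 2) S) :
    logDeriv i F = X i * pderiv S i F := rfl

theorem coeff_logDeriv (i : Fin 2) (e : Fin 2 →₀ ℕ) (F : MvPowerSeries (Fin 2) S) :
    coeff e (logDeriv i F) = (e i : S) * coeff e F := by
  classical
  rw [logDeriv_apply, X, coeff_monomial_mul]
  split_ifs with h
  · have hi : 1 ≤ e i := by simpa using h i
    rw [coeff_pderiv, tsub_add_cancel_of_le h, one_mul, Finsupp.tsub_apply,
      Finsupp.single_eq_same, Nat.cast_sub hi]
    push_cast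
    ring
  · have hi : e i = 0 := by
      by_contra hne
      exact h (by rw [Finsupp.single_le_iff]; omega)
    simp [hi]

theorem logDeriv_mul (i : Fin 2) (F G : MvPowerSeries (Fin 2) S) :
    logDeriv i (F * G) = F * logDeriv i G + G * logDeriv i F := by
  simp [Derivation.leibniz]

theorem logDeriv_comm (F : MvPowerSeries (Fin 2) S) :
    logDeriv 0 (logDeriv 1 F) = logDeriv 1 (logDeriv 0 F) := by
  ext e
  simp only [coeff_logDeriv]
  ring

theorem order_le_order_logDeriv (i : Fin 2) (F : MvPowerSeries (Fin 2) S) :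
    F.order ≤ (logDeriv i F).order :=
  le_order fun e he => by rw [coeff_logDeriv, coeff_of_lt_order he, mul_zero]

theorem logDeriv_monomial (i : Fin 2) (e : Fin 2 →₀ ℕ) (c : S) :
    logDeriv i (monomial e c) = (e i : MvPowerSeries (Fin 2) S) * monomial e c := by
  classical
  ext f
  rw [coeff_logDeriv, ← nsmul_eq_mul (e i) (monomial e c), map_nsmul, nsmul_eq_mul, coeff_monomial]
  split_ifs with h
  · rw [h]
  · simp

/-- Only the constant term of `A` can meet a term of `F` of lowest possible degree. -/
theorem coeff_mul_of_degree_le_order {A F : MvPowerSeries (Fin 2) S} {e : Fin 2 →₀ ℕ}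
    (h : (e.degree : ℕ∞) ≤ F.order) :
    coeff e (A * F) = constantCoeff A * coeff e F := by
  have h1 : 1 ≤ (A - C (constantCoeff A)).order := by
    rw [one_le_order_iff_constCoeff_eq_zero]
    simp
  have h2 : coeff e ((A - C (constantCoeff A)) * F) = 0 := by
    apply coeff_of_lt_order
    refine lt_of_lt_of_le ?_ ((add_le_add h1 h).trans le_order_mul)
    rw [add_comm]
    exact_mod_cast Nat.lt_succ_self _
  rw [sub_mul, map_sub, coeff_C_mul, sub_eq_zero] at h2
  exact h2

/-! ### Exponentials of power series. -/

/-- The exponential of `s • Φ`, for `Φ` a power series without constant term. -/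
noncomputable def expSeries [Algebra ℚ S] (Φ : MvPowerSeries (Fin 2) S) (s : S) :
    MvPowerSeries (Fin 2) S :=
  (PowerSeries.rescale s (PowerSeries.exp S)).subst Φ

section Exponential

variable [Algebra ℚ S] {Φ : MvPowerSeries (Fin 2) S}

/-- Since `Φ ^ d` has order at least `d`, a truncated exponential suffices in each degree; this
turns later identities into finite sums. -/
theorem coeff_expSeries (hΦ : constantCoeff Φ = 0) (s : S) {D : ℕ} {e : Fin 2 →₀ ℕ}
    (he : e.degree < D) :
    coeff e (expSeries Φ s) =
      coeff e (∑ d ∈ Finset.range D, C (s ^ d * algebraMap ℚ S (1 / d.factorial)) * Φ ^ d) := by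
  rw [expSeries, PowerSeries.coeff_subst (PowerSeries.HasSubst.of_constantCoeff_zero hΦ),
    finsum_eq_sum_of_support_subset (s := Finset.range D), map_sum]
  · refine Finset.sum_congr rfl fun d _ => ?_
    rw [coeff_C_mul, PowerSeries.coeff_rescale, PowerSeries.coeff_exp, smul_eq_mul]
  · intro d hd
    by_contra hD
    refine hd ?_
    simp only [Finset.coe_range, Set.mem_Iio, not_lt] at hD
    have : coeff e (Φ ^ d) = 0 := by
      apply coeff_of_lt_order
      refine lt_of_lt_of_le ?_ (le_order_pow_of_constantCoeff_eq_zero d hΦ)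
      exact_mod_cast lt_of_lt_of_le he hD
    simp only [this, smul_zero]

theorem expSeries_add (hΦ : constantCoeff Φ = 0) (s t : S) :
    expSeries Φ (s + t) = expSeries Φ s * expSeries Φ t := by
  rw [expSeries, ← PowerSeries.exp_mul_exp_eq_exp_add,
    PowerSeries.subst_mul (PowerSeries.HasSubst.of_constantCoeff_zero hΦ)]
  rfl

theorem constantCoeff_expSeries (hΦ : constantCoeff Φ = 0) (s : S) :
    constantCoeff (expSeries Φ s) = 1 := by
  rw [← coeff_zero_eq_constantCoeff_apply, coeff_expSeries hΦ s (D := 1) (by simp)]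
  simp

theorem logDeriv_expSeries (hΦ : constantCoeff Φ = 0) (i : Fin 2) (s : S) :
    logDeriv i (expSeries Φ s) = C s * logDeriv i Φ * expSeries Φ s := by
  ext e
  have key : ∀ D, logDeriv i
      (∑ d ∈ Finset.range (D + 1), C (s ^ d * algebraMap ℚ S (1 / d.factorial)) * Φ ^ d) =
      C s * logDeriv i Φ *
        ∑ d ∈ Finset.range D, C (s ^ d * algebraMap ℚ S (1 / d.factorial)) * Φ ^ d := by
    intro D
    rw [Finset.sum_range_succ', map_add, map_sum, Finset.mul_sum]
    have h0 : logDeriv i (C (s ^ 0 * algebraMap ℚ S (1 / (Nat.factorial 0))) * Φ ^ 0) = 0 := by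
      simp
    rw [h0, add_zero]
    refine Finset.sum_congr rfl fun d _ => ?_
    rw [logDeriv_mul, logDeriv_apply i (C _), pderiv_C, mul_zero, mul_zero, add_zero,
      Derivation.leibniz_pow, Nat.add_sub_cancel, smul_eq_mul, nsmul_eq_mul]
    have : (algebraMap ℚ S (1 / d.factorial)) =
        algebraMap ℚ S (1 / (d + 1).factorial) * ((d + 1 : ℕ) : S) := by
      rw [← map_natCast (algebraMap ℚ S), ← map_mul]
      congr 1
      rw [Nat.factorial_succ]
      have := Nat.factorial_ne_zero d
      push_cast
      field_simp
    rw [this]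
    simp only [map_mul, map_pow, map_natCast]
    ring
  have h1 : coeff e (logDeriv i (expSeries Φ s)) = coeff e (logDeriv i
      (∑ d ∈ Finset.range (e.degree + 1 + 1),
        C (s ^ d * algebraMap ℚ S (1 / d.factorial)) * Φ ^ d)) := by
    rw [coeff_logDeriv, coeff_logDeriv, coeff_expSeries hΦ s (D := e.degree + 1 + 1) (by omega)]
  rw [h1, key]
  classical
  rw [coeff_mul, coeff_mul]
  refine Finset.sum_congr rfl fun ab hab => ?_
  rw [coeff_expSeries hΦ s (D := e.degree + 1)]
  have := congrArg Finsupp.degree (Finset.HasAntidiagonal.mem_antidiagonal.mp hab)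
  rw [map_add] at this
  omega

end Exponential

/-! ### Resonant series and the Hamiltonian field. -/

section

variable {S : Type*} [CommRing S]

theorem IsResonantSeries.le_order {p q : ℕ} {L : ℕ → S} {F : MvPowerSeries (Fin 2) S}
    (hF : IsResonantSeries p q L F) {n : ℕ} (hL : ∀ j, 1 ≤ j → j < n → L j = 0) :
    (((n + 1) * (p + q) : ℕ) : ℕ∞) ≤ F.order := by
  refine nat_le_order fun e he => ?_
  by_cases h : ∃ k, 1 ≤ k ∧ e = resonantExp p q (k + 1)
  · obtain ⟨k, hk, rfl⟩ := h
    rw [hF.1 k hk, hL k hk]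
    rw [degree_resonantExp] at he
    have := lt_of_mul_lt_mul_right he (Nat.zero_le _)
    omega
  · push Not at h
    exact hF.2 e h

/-- Allows the first nonzero saddle value to be read off after multiplication by a unit such as
`exp(-NΦ)`. -/
theorem IsResonantSeries.coeff_mul {p q : ℕ} {L : ℕ → S} {F : MvPowerSeries (Fin 2) S}
    (hF : IsResonantSeries p q L F) {n : ℕ} (hn : 1 ≤ n) (hL : ∀ j, 1 ≤ j → j < n → L j = 0)
    (A : MvPowerSeries (Fin 2) S) :
    coeff (resonantExp p q (n + 1)) (A * F) = constantCoeff A * L n := by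
  rw [coeff_mul_of_degree_le_order, hF.1 n hn]
  rw [degree_resonantExp]
  exact hF.le_order hL

theorem IsResonantSeries.C_mul {p q : ℕ} {L : ℕ → S} {F : MvPowerSeries (Fin 2) S}
    (hF : IsResonantSeries p q L F) (a : S) :
    IsResonantSeries p q (fun j => a * L j) (C a * F) :=
  ⟨fun k hk => by rw [coeff_C_mul, hF.1 k hk],
    fun m hm => by rw [coeff_C_mul, hF.2 m hm, mul_zero]⟩

/-- The derivation `(p + y ∂Φ/∂y) x ∂/∂x - (q + x ∂Φ/∂x) y ∂/∂y`: in the variables `log x`, `log y`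
it is the Hamiltonian vector field of `q log x + p log y + Φ`. -/
noncomputable def hamField (p q : ℕ) (Φ F : MvPowerSeries (Fin 2) S) : MvPowerSeries (Fin 2) S :=
  ((p : MvPowerSeries (Fin 2) S) + logDeriv 1 Φ) * logDeriv 0 F -
    ((q : MvPowerSeries (Fin 2) S) + logDeriv 0 Φ) * logDeriv 1 F

theorem hamField_sub (p q : ℕ) (Φ F G : MvPowerSeries (Fin 2) S) :
    hamField p q Φ (F - G) = hamField p q Φ F - hamField p q Φ G := by
  simp only [hamField, map_sub]
  ring

theorem logDeriv_C_mul (i : Fin 2) (a : S) (F : MvPowerSeries (Fin 2) S) :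
    logDeriv i (C a * F) = C a * logDeriv i F := by
  rw [← smul_eq_C_mul, Derivation.map_smul, smul_eq_C_mul]

theorem hamField_C_mul (p q : ℕ) (a : S) (Φ F : MvPowerSeries (Fin 2) S) :
    hamField p q Φ (C a * F) = C a * hamField p q Φ F := by
  simp only [hamField, logDeriv_C_mul]
  ring

theorem le_order_monomial (e : Fin 2 →₀ ℕ) (c : S) :
    (e.degree : ℕ∞) ≤ (monomial e c : MvPowerSeries (Fin 2) S).order := by
  refine nat_le_order fun f hf => coeff_monomial_ne ?_ c
  rintro rfl
  exact lt_irrefl _ hf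

theorem constantCoeff_logDeriv (i : Fin 2) (F : MvPowerSeries (Fin 2) S) :
    constantCoeff (logDeriv i F) = 0 := by
  rw [← coeff_zero_eq_constantCoeff_apply, coeff_logDeriv]
  simp

end

/-! ### Residues, first integrals and the Melnikov formula. -/

section

variable {S : Type*} [CommRing S] [Algebra ℚ S]

theorem eq_zero_of_intCast_mul_eq_zero {a : ℤ} (ha : a ≠ 0) {c : S} (h : (a : S) * c = 0) :
    c = 0 := by
  have h1 : algebraMap ℚ S ((a : ℚ)⁻¹) * (a : S) = 1 := by
    rw [← map_intCast (algebraMap ℚ S), ← map_mul, inv_mul_cancel₀ (by exact_mod_cast ha), map_one]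
  rw [← one_mul c, ← h1, mul_assoc, h, mul_zero]

theorem eq_zero_of_natCast_mul_eq_zero {a : ℕ} (ha : a ≠ 0) {c : S} (h : (a : S) * c = 0) :
    c = 0 :=
  eq_zero_of_intCast_mul_eq_zero (a := a) (by exact_mod_cast ha) (by exact_mod_cast h)

variable {Φ : MvPowerSeries (Fin 2) S}

/-- This coefficient is the residue of `I^{-N} X_Φ G`, with `I = x^q y^p exp Φ`. It vanishes because
`X_Φ` kills `I` and is divergence free, so the integrand is a total divergence. -/
theorem coeff_expSeries_mul_hamField (hΦ : constantCoeff Φ = 0) (p q N : ℕ)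
    (G : MvPowerSeries (Fin 2) S) :
    coeff (resonantExp p q N) (expSeries Φ (-(N : S)) * hamField p q Φ G) = 0 := by
  set E := expSeries Φ (-(N : S)) with hE
  have h0 : logDeriv 0 E = -(N : MvPowerSeries (Fin 2) S) * logDeriv 0 Φ * E := by
    rw [hE, logDeriv_expSeries hΦ]; simp
  have h1 : logDeriv 1 E = -(N : MvPowerSeries (Fin 2) S) * logDeriv 1 Φ * E := by
    rw [hE, logDeriv_expSeries hΦ]; simp
  have hc : ∀ (i : Fin 2) (a : ℕ), logDeriv i (a : MvPowerSeries (Fin 2) S) = 0 := fun i a =>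
    Derivation.map_natCast _ a
  -- Divergence form. At the exponent `N (q, p)` the logarithmic derivations multiply by `N q` and
  -- `N p`, which cancels the two correction terms.
  have key : E * hamField p q Φ G =
      logDeriv 0 (((p : MvPowerSeries (Fin 2) S) + logDeriv 1 Φ) * (E * G)) -
      logDeriv 1 (((q : MvPowerSeries (Fin 2) S) + logDeriv 0 Φ) * (E * G)) +
      C ((N : S) * p) * (logDeriv 0 Φ * (E * G)) - C ((N : S) * q) * (logDeriv 1 Φ * (E * G)) := by
    simp only [logDeriv_mul, map_add, hc, h0, h1, logDeriv_comm, hamField, map_mul, map_natCast]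
    ring
  have hp : (p : MvPowerSeries (Fin 2) S) = C (p : S) := by simp
  have hq : (q : MvPowerSeries (Fin 2) S) = C (q : S) := by simp
  rw [key, hp, hq]
  simp only [map_add, map_sub, coeff_C_mul, coeff_logDeriv, add_mul, resonantExp_zero_apply,
    resonantExp_one_apply]
  push_cast
  ring

/-- The power `(x ^ q * y ^ p * exp Φ) ^ m` of the first integral of `hamField p q Φ`. -/
noncomputable def integralPow (p q : ℕ) (Φ : MvPowerSeries (Fin 2) S) (m : ℕ) :
    MvPowerSeries (Fin 2) S :=
  monomial (resonantExp p q m) 1 * expSeries Φ (m : S)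

theorem logDeriv_zero_integralPow (hΦ : constantCoeff Φ = 0) (p q m : ℕ) :
    logDeriv 0 (integralPow p q Φ m) = (m : MvPowerSeries (Fin 2) S) *
      ((q : MvPowerSeries (Fin 2) S) + logDeriv 0 Φ) * integralPow p q Φ m := by
  rw [integralPow, logDeriv_mul, logDeriv_monomial, logDeriv_expSeries hΦ]
  simp only [resonantExp_zero_apply, map_natCast]
  push_cast
  ring

theorem logDeriv_one_integralPow (hΦ : constantCoeff Φ = 0) (p q m : ℕ) :
    logDeriv 1 (integralPow p q Φ m) = (m : MvPowerSeries (Fin 2) S) *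
      ((p : MvPowerSeries (Fin 2) S) + logDeriv 1 Φ) * integralPow p q Φ m := by
  rw [integralPow, logDeriv_mul, logDeriv_monomial, logDeriv_expSeries hΦ]
  simp only [resonantExp_one_apply, map_natCast]
  push_cast
  ring

theorem hamField_integralPow (hΦ : constantCoeff Φ = 0) (p q m : ℕ) :
    hamField p q Φ (integralPow p q Φ m) = 0 := by
  rw [hamField, logDeriv_zero_integralPow hΦ, logDeriv_one_integralPow hΦ]
  ring

theorem le_order_integralPow (p q m : ℕ) :
    ((m * (p + q) : ℕ) : ℕ∞) ≤ (integralPow p q Φ m).order := by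
  rw [integralPow, ← degree_resonantExp p q m]
  exact ((le_order_monomial _ 1).trans le_self_add).trans le_order_mul

theorem coeff_integralPow (hΦ : constantCoeff Φ = 0) (p q m : ℕ) :
    coeff (resonantExp p q m) (integralPow p q Φ m) = 1 := by
  rw [integralPow, mul_comm, coeff_mul_of_degree_le_order (le_order_monomial _ _),
    constantCoeff_expSeries hΦ, coeff_monomial_same, one_mul]

/-- On lowest-degree terms the field acts diagonally with eigenvalues `p e₀ - q e₁`, so a lowest
term of a kernel element is resonant. -/
theorem le_order_of_hamField_eq_zero {p q : ℕ} (hp : 0 < p) (hpq : Nat.Coprime p q)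
    {F : MvPowerSeries (Fin 2) S} (hF : hamField p q Φ F = 0) {M : ℕ}
    (h : ∀ m ≤ M, coeff (resonantExp p q m) F = 0) :
    (((M + 1) * (p + q) : ℕ) : ℕ∞) ≤ F.order := by
  refine nat_le_order fun e he => ?_
  induction hd : e.degree using Nat.strong_induction_on generalizing e with
  | _ D ih =>
    have hord : (e.degree : ℕ∞) ≤ F.order :=
      nat_le_order fun f hf => ih f.degree (hd ▸ hf) f (hf.trans he) rfl
    have h0 := congrArg (coeff e) hF
    have hP : (p : MvPowerSeries (Fin 2) S) = C (p : S) := by simp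
    have hQ : (q : MvPowerSeries (Fin 2) S) = C (q : S) := by simp
    rw [hamField, hP, hQ, map_sub,
      coeff_mul_of_degree_le_order (hord.trans (order_le_order_logDeriv 0 F)),
      coeff_mul_of_degree_le_order (hord.trans (order_le_order_logDeriv 1 F)),
      coeff_logDeriv, coeff_logDeriv, map_add, map_add, constantCoeff_logDeriv,
      constantCoeff_logDeriv, constantCoeff_C, constantCoeff_C, (coeff e).map_zero] at h0
    by_cases hres : p * e 0 = q * e 1
    · obtain ⟨k, rfl⟩ := exists_eq_resonantExp hp hpq hres
      rw [degree_resonantExp] at he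
      have := lt_of_mul_lt_mul_right he (Nat.zero_le _)
      exact h k (by omega)
    · refine eq_zero_of_intCast_mul_eq_zero (a := (p : ℤ) * e 0 - q * e 1) ?_ ?_
      · rw [sub_ne_zero]
        exact_mod_cast hres
      · push_cast
        linear_combination h0

/-- Kernel elements are power series in `I`: subtracting a multiple of `I^m` removes the resonant
term of index `m` and stays in the kernel, so the order jumps to the next resonant degree. -/
theorem exists_le_order_sub_sum_integralPow {p q : ℕ} (hp : 0 < p) (hpq : Nat.Coprime p q)
    (hΦ : constantCoeff Φ = 0) {F : MvPowerSeries (Fin 2) S} (hF : hamField p q Φ F = 0)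
    (hF0 : constantCoeff F = 0) (M : ℕ) :
    ∃ c : ℕ → S, (((M + 1) * (p + q) : ℕ) : ℕ∞) ≤
      (F - ∑ m ∈ Finset.Icc 1 M, C (c m) * integralPow p q Φ m).order := by
  suffices ∃ c : ℕ → S,
      hamField p q Φ (F - ∑ m ∈ Finset.Icc 1 M, C (c m) * integralPow p q Φ m) = 0 ∧
      (((M + 1) * (p + q) : ℕ) : ℕ∞) ≤
      (F - ∑ m ∈ Finset.Icc 1 M, C (c m) * integralPow p q Φ m).order from
    this.imp fun _ h => h.2
  induction M with
  | zero =>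
    refine ⟨0, by simpa using hF, ?_⟩
    have h := le_order_of_hamField_eq_zero hp hpq hF (M := 0) fun m hm => by
      obtain rfl : m = 0 := by omega
      have : resonantExp p q 0 = 0 := exponent_ext (by simp) (by simp)
      rw [this, coeff_zero_eq_constantCoeff_apply, hF0]
    simpa using h
  | succ M ih =>
    obtain ⟨c, hc, hord⟩ := ih
    set G := F - ∑ m ∈ Finset.Icc 1 M, C (c m) * integralPow p q Φ m with hG
    refine ⟨Function.update c (M + 1) (coeff (resonantExp p q (M + 1)) G), ?_⟩
    have hsum : F - ∑ m ∈ Finset.Icc 1 (M + 1),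
        C (Function.update c (M + 1) (coeff (resonantExp p q (M + 1)) G) m) *
          integralPow p q Φ m =
        G - C (coeff (resonantExp p q (M + 1)) G) * integralPow p q Φ (M + 1) := by
      rw [Finset.sum_Icc_succ_top (by omega), Function.update_self, hG, sub_sub]
      congr 2
      refine Finset.sum_congr rfl fun m hm => ?_
      rw [Function.update_of_ne]
      have := (Finset.mem_Icc.mp hm).2
      omega
    rw [hsum]
    have hker : hamField p q Φ
        (G - C (coeff (resonantExp p q (M + 1)) G) * integralPow p q Φ (M + 1)) = 0 := by
      rw [hamField_sub, hc, hamField_C_mul, hamField_integralPow hΦ, mul_zero, sub_zero]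
    refine ⟨hker, le_order_of_hamField_eq_zero hp hpq hker fun m hm => ?_⟩
    rw [map_sub, coeff_C_mul]
    rcases hm.lt_or_eq with hm | rfl
    · have hlt : (resonantExp p q m).degree < (M + 1) * (p + q) := by
        rw [degree_resonantExp]
        exact Nat.mul_lt_mul_of_pos_right hm (by omega)
      rw [coeff_of_lt_order (lt_of_lt_of_le (by exact_mod_cast hlt) hord),
        coeff_of_lt_order (lt_of_lt_of_le (by exact_mod_cast hlt) (le_order_integralPow p q _)),
        mul_zero, sub_zero]
    · rw [coeff_integralPow hΦ, mul_one, sub_self]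

/-- Integration by parts: the residue of `x ∂/∂x (W I^{-κ})` is zero. -/
theorem natCast_mul_coeff_expSeries (hΦ : constantCoeff Φ = 0) (p q κ : ℕ)
    (W : MvPowerSeries (Fin 2) S) :
    (κ : S) * coeff (resonantExp p q κ)
      (W * ((q : MvPowerSeries (Fin 2) S) + logDeriv 0 Φ) * expSeries Φ (-(κ : S))) =
    coeff (resonantExp p q κ) (logDeriv 0 W * expSeries Φ (-(κ : S))) := by
  have h := coeff_logDeriv 0 (resonantExp p q κ) (W * expSeries Φ (-(κ : S)))
  have hQ : (q : MvPowerSeries (Fin 2) S) = C (q : S) := by simp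
  rw [logDeriv_mul, logDeriv_expSeries hΦ, resonantExp_zero_apply] at h
  have h1 : W * ((q : MvPowerSeries (Fin 2) S) + logDeriv 0 Φ) * expSeries Φ (-(κ : S)) =
      C (q : S) * (W * expSeries Φ (-(κ : S))) + W * logDeriv 0 Φ * expSeries Φ (-(κ : S)) := by
    rw [hQ]; ring
  have h2 : W * (C (-(κ : S)) * logDeriv 0 Φ * expSeries Φ (-(κ : S))) +
      expSeries Φ (-(κ : S)) * logDeriv 0 W =
      C (-(κ : S)) * (W * logDeriv 0 Φ * expSeries Φ (-(κ : S))) +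
        logDeriv 0 W * expSeries Φ (-(κ : S)) := by ring
  rw [h1, map_add, coeff_C_mul]
  rw [h2, map_add, coeff_C_mul] at h
  push_cast at h
  linear_combination -h

/-- Here `I^{-(m+κ)} x ∂(I^m)/∂x = m (q + x Φ_x) I^{-κ}`, so the contribution of `I^m` at level `m +
κ` is a multiple of the Melnikov number of index `κ`. -/
theorem natCast_mul_coeff_integralPow (hΦ : constantCoeff Φ = 0) (p q m κ : ℕ)
    (W : MvPowerSeries (Fin 2) S) :
    (κ : S) * coeff (resonantExp p q (m + κ))
      (expSeries Φ (-((m + κ : ℕ) : S)) * (W * logDeriv 0 (integralPow p q Φ m))) =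
    (m : S) * coeff (resonantExp p q κ) (logDeriv 0 W * expSeries Φ (-(κ : S))) := by
  have hadd : resonantExp p q (m + κ) = resonantExp p q m + resonantExp p q κ :=
    exponent_ext (by simp [add_mul]) (by simp [add_mul])
  have hE : expSeries Φ (-(κ : S)) = expSeries Φ (-((m + κ : ℕ) : S)) * expSeries Φ (m : S) := by
    rw [← expSeries_add hΦ]
    congr 1
    push_cast
    ring
  have h : expSeries Φ (-((m + κ : ℕ) : S)) * (W * logDeriv 0 (integralPow p q Φ m)) =
      monomial (resonantExp p q m) 1 * (C (m : S) *
        (W * ((q : MvPowerSeries (Fin 2) S) + logDeriv 0 Φ) * expSeries Φ (-(κ : S)))) := by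
    rw [logDeriv_zero_integralPow hΦ, hE, integralPow, map_natCast]
    ring
  rw [h, hadd, coeff_add_monomial_mul, one_mul, coeff_C_mul, ← natCast_mul_coeff_expSeries hΦ]
  ring

/-- If the vector field `hamField p q Φ` is perturbed by `ε W x ∂/∂x`, where `ε ^ 2 = 0`, then its
first nonzero saddle value is given by a Melnikov-type integral. -/
theorem saddleValue_of_perturbation {p q : ℕ} (hp : 0 < p) (hpq : Nat.Coprime p q)
    (hΦ : constantCoeff Φ = 0) {W : MvPowerSeries (Fin 2) S} (hW : constantCoeff W = 0)
    {ε : S} (hε : ε * ε = 0) {H : MvPowerSeries (Fin 2) S} (hH : HasResonantLeadingTerm p q H)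
    {L : ℕ → S} (hL : IsResonantSeries p q L (hamField p q Φ H + C ε * (W * logDeriv 0 H)))
    {k : ℕ} (hk : 1 ≤ k)
    (hvan : ∀ κ, 1 ≤ κ → κ < k →
      coeff (resonantExp p q κ) (logDeriv 0 W * expSeries Φ (-(κ : S))) = 0) :
    (∀ j, 1 ≤ j → j < k → L j = 0) ∧
      (k : S) * L k = ε * coeff (resonantExp p q k) (logDeriv 0 W * expSeries Φ (-(k : S))) := by
  -- Multiplication by `ε` removes the perturbation. The residue identity then forces `ε L j = 0`
  -- for every `j ≥ 1`, by induction on `j`.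
  have hker : hamField p q Φ (C ε * H) = 0 := by
    have h1 := hL.C_mul ε
    have h2 : C ε * (hamField p q Φ H + C ε * (W * logDeriv 0 H)) = hamField p q Φ (C ε * H) := by
      rw [mul_add, ← mul_assoc, ← map_mul C, hε, map_zero, zero_mul, add_zero, hamField_C_mul]
    rw [h2] at h1
    have h3 : ∀ j, 1 ≤ j → ε * L j = 0 := by
      intro j
      induction j using Nat.strong_induction_on with
      | _ j ih =>
        intro hj
        have := coeff_expSeries_mul_hamField hΦ p q (j + 1) (C ε * H)
        rwa [h1.coeff_mul hj (fun i hi hij => ih i hij hi), constantCoeff_expSeries hΦ,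
          one_mul] at this
    ext e
    by_cases h : ∃ k, 1 ≤ k ∧ e = resonantExp p q (k + 1)
    · obtain ⟨k, hk, rfl⟩ := h
      exact (h1.1 k hk).trans ((h3 k hk).trans (map_zero _).symm)
    · push Not at h
      rw [h1.2 e h, map_zero]
  have hconst : constantCoeff (C ε * H) = 0 := by
    have h0 : (0 : Fin 2 →₀ ℕ) ≠ resonantExp p q 1 := by
      intro h
      have := DFunLike.congr_fun h 1
      simp at this
      omega
    rw [map_mul, ← coeff_zero_eq_constantCoeff_apply H, hH.2 0 (by simp) h0, mul_zero]
  -- Expand `εH` in powers of `I`; the leading term of `H` fixes `c 1 = ε`. The remainder does not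
  -- contribute, since `W` without constant term pushes it beyond degree `(N+1)(p+q)`.
  have hT : ∀ N : ℕ, ∃ c : ℕ → S, (1 ≤ N → c 1 = ε) ∧ coeff (resonantExp p q (N + 1))
      (expSeries Φ (-((N + 1 : ℕ) : S)) * (hamField p q Φ H + C ε * (W * logDeriv 0 H))) =
      ∑ m ∈ Finset.Icc 1 N, c m * coeff (resonantExp p q (N + 1))
        (expSeries Φ (-((N + 1 : ℕ) : S)) * (W * logDeriv 0 (integralPow p q Φ m))) := by
    intro N
    obtain ⟨c, hc⟩ := exists_le_order_sub_sum_integralPow hp hpq hΦ hker hconst N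
    have hpos : 0 < p + q := by omega
    refine ⟨c, fun hN => ?_, ?_⟩
    · have h1 : coeff (resonantExp p q 1)
          (C ε * H - ∑ m ∈ Finset.Icc 1 N, C (c m) * integralPow p q Φ m) = 0 := by
        refine coeff_of_lt_order (lt_of_lt_of_le ?_ hc)
        rw [degree_resonantExp]
        exact_mod_cast Nat.mul_lt_mul_of_pos_right (show 1 < N + 1 by omega) hpos
      rw [map_sub, map_sum, coeff_C_mul, hH.1, mul_one,
        Finset.sum_eq_single_of_mem 1 (Finset.mem_Icc.mpr ⟨le_rfl, hN⟩), coeff_C_mul,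
        coeff_integralPow hΦ, mul_one, sub_eq_zero] at h1
      · exact h1.symm
      · intro m hm hm1
        rw [coeff_C_mul, coeff_of_lt_order, mul_zero]
        refine lt_of_lt_of_le ?_ (le_order_integralPow p q m)
        rw [degree_resonantExp]
        have := (Finset.mem_Icc.mp hm).1
        exact_mod_cast Nat.mul_lt_mul_of_pos_right (show 1 < m by omega) hpos
    · set G := C ε * H - ∑ m ∈ Finset.Icc 1 N, C (c m) * integralPow p q Φ m with hG
      have hrest : coeff (resonantExp p q (N + 1))
          (expSeries Φ (-((N + 1 : ℕ) : S)) * (W * logDeriv 0 G)) = 0 := by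
        apply coeff_of_lt_order
        have hW1 : 1 ≤ W.order := one_le_order_iff_constCoeff_eq_zero.mpr hW
        have h1 : (1 + ((N + 1) * (p + q) : ℕ) : ℕ∞) ≤ (W * logDeriv 0 G).order :=
          (add_le_add hW1 (hc.trans (order_le_order_logDeriv 0 G))).trans le_order_mul
        refine lt_of_lt_of_le ?_ ((h1.trans le_add_self).trans le_order_mul)
        rw [degree_resonantExp]
        exact_mod_cast Nat.lt_one_add_iff.mpr le_rfl
      have hsplit : C ε * (W * logDeriv 0 H) = W * logDeriv 0 G +
          ∑ m ∈ Finset.Icc 1 N, C (c m) * (W * logDeriv 0 (integralPow p q Φ m)) := by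
        have : W * logDeriv 0 (C ε * H) = W * logDeriv 0
            (G + ∑ m ∈ Finset.Icc 1 N, C (c m) * integralPow p q Φ m) := by
          rw [hG, sub_add_cancel]
        rw [logDeriv_C_mul, map_add, map_sum, mul_add, Finset.mul_sum] at this
        rw [mul_left_comm, this]
        congr 1
        refine Finset.sum_congr rfl fun m _ => ?_
        rw [logDeriv_C_mul, mul_left_comm]
      rw [mul_add, map_add, coeff_expSeries_mul_hamField hΦ, zero_add, hsplit, mul_add, map_add,
        hrest, zero_add, Finset.mul_sum, map_sum]
      refine Finset.sum_congr rfl fun m _ => ?_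
      rw [mul_left_comm, coeff_C_mul]
  have hmel : ∀ N m, m ∈ Finset.Icc 1 N → ((N + 1 - m : ℕ) : S) * coeff (resonantExp p q (N + 1))
      (expSeries Φ (-((N + 1 : ℕ) : S)) * (W * logDeriv 0 (integralPow p q Φ m))) =
      (m : S) * coeff (resonantExp p q (N + 1 - m))
        (logDeriv 0 W * expSeries Φ (-((N + 1 - m : ℕ) : S))) := by
    intro N m hm
    have h := natCast_mul_coeff_integralPow hΦ p q m (N + 1 - m) W
    rwa [Nat.add_sub_cancel' (by have := (Finset.mem_Icc.mp hm).2; omega)] at h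
  have hmel0 : ∀ N m, m ∈ Finset.Icc 1 N → N + 1 - m < k → coeff (resonantExp p q (N + 1))
      (expSeries Φ (-((N + 1 : ℕ) : S)) * (W * logDeriv 0 (integralPow p q Φ m))) = 0 := by
    intro N m hm hlt
    have hm' := Finset.mem_Icc.mp hm
    have h := hmel N m hm
    rw [hvan _ (by omega) hlt, mul_zero] at h
    exact eq_zero_of_natCast_mul_eq_zero (by omega) h
  have hzero : ∀ j, 1 ≤ j → j < k → L j = 0 := by
    intro j
    induction j using Nat.strong_induction_on with
    | _ j ih =>
      intro hj hjk
      obtain ⟨c, -, hc⟩ := hT j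
      rw [hL.coeff_mul hj (fun i hi hij => ih i hij hi (hij.trans hjk)),
        constantCoeff_expSeries hΦ, one_mul] at hc
      rw [hc]
      refine Finset.sum_eq_zero fun m hm => ?_
      have := Finset.mem_Icc.mp hm
      rw [hmel0 j m hm (by omega), mul_zero]
  refine ⟨hzero, ?_⟩
  -- The power `I^m` involves index `k + 1 - m`, which is below `k` unless `m = 1`.
  obtain ⟨c, hc1, hc⟩ := hT k
  rw [hL.coeff_mul hk hzero, constantCoeff_expSeries hΦ, one_mul,
    Finset.sum_eq_single_of_mem 1 (Finset.mem_Icc.mpr ⟨le_rfl, hk⟩), hc1 hk] at hc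
  · have h := hmel k 1 (Finset.mem_Icc.mpr ⟨le_rfl, hk⟩)
    rw [Nat.add_sub_cancel, Nat.cast_one, one_mul] at h
    rw [hc, mul_left_comm, h]
  · intro m hm hm1
    have := Finset.mem_Icc.mp hm
    rw [hmel0 k m hm (by omega), mul_zero]

end

/-! ### The exponential of a sum of two monomials. -/

section

variable {S : Type*} [CommRing S]

theorem monomial_pow_mul_monomial_pow (u v : Fin 2 →₀ ℕ) (i j : ℕ) :
    (monomial u 1 ^ i * monomial v 1 ^ j : MvPowerSeries (Fin 2) S) =
      monomial (i • u + j • v) 1 := by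
  rw [monomial_pow, monomial_pow, monomial_mul_monomial, one_pow, one_pow, one_mul]

theorem coeff_add_monomial_pow (u v f : Fin 2 →₀ ℕ) (d : ℕ) :
    coeff f ((monomial u 1 + monomial v 1) ^ d : MvPowerSeries (Fin 2) S) =
      ∑ i ∈ Finset.range (d + 1),
        coeff f (monomial (i • u + (d - i) • v) (1 : S)) * (d.choose i : S) := by
  rw [add_pow, map_sum]
  refine Finset.sum_congr rfl fun i _ => ?_
  rw [monomial_pow_mul_monomial_pow]
  have : ((d.choose i : ℕ) : MvPowerSeries (Fin 2) S) = C (d.choose i : S) := by simp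
  rw [this, coeff_mul_C]

theorem constantCoeff_monomial {u : Fin 2 →₀ ℕ} (hu : 0 < u.degree) (c : S) :
    constantCoeff (monomial u c) = 0 := by
  rw [← coeff_zero_eq_constantCoeff_apply]
  refine coeff_monomial_ne ?_ c
  rintro rfl
  simp at hu

variable [Algebra ℚ S]

theorem coeff_expSeries_eq_zero {u v : Fin 2 →₀ ℕ} (hu : 0 < u.degree) (hv : 0 < v.degree)
    {f : Fin 2 →₀ ℕ} (hf : ∀ a b : ℕ, f ≠ a • u + b • v) (s : S) :
    coeff f (expSeries (monomial u 1 + monomial v 1) s) = 0 := by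
  have hΦ : constantCoeff (monomial u 1 + monomial v 1 : MvPowerSeries (Fin 2) S) = 0 := by
    rw [map_add, constantCoeff_monomial hu, constantCoeff_monomial hv, add_zero]
  rw [coeff_expSeries hΦ s (Nat.lt_succ_self _), map_sum]
  refine Finset.sum_eq_zero fun d _ => ?_
  rw [coeff_C_mul, coeff_add_monomial_pow]
  refine mul_eq_zero_of_right _ (Finset.sum_eq_zero fun i _ => ?_)
  rw [coeff_monomial_ne (hf _ _), zero_mul]

theorem coeff_expSeries_smul_add_smul {u v : Fin 2 →₀ ℕ} (hu : 0 < u.degree) (hv : 0 < v.degree)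
    {a b : ℕ} (huniq : ∀ i j : ℕ, a • u + b • v = i • u + j • v → i = a ∧ j = b) (s : S) :
    coeff (a • u + b • v) (expSeries (monomial u 1 + monomial v 1) s) =
      s ^ (a + b) * algebraMap ℚ S (1 / (a.factorial * b.factorial)) := by
  have hΦ : constantCoeff (monomial u 1 + monomial v 1 : MvPowerSeries (Fin 2) S) = 0 := by
    rw [map_add, constantCoeff_monomial hu, constantCoeff_monomial hv, add_zero]
  have hdeg : a + b ≤ (a • u + b • v).degree := by
    rw [map_add, map_nsmul, map_nsmul, smul_eq_mul, smul_eq_mul]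
    exact add_le_add (Nat.le_mul_of_pos_right _ hu) (Nat.le_mul_of_pos_right _ hv)
  rw [coeff_expSeries hΦ s (Nat.lt_succ_self _), map_sum,
    Finset.sum_eq_single_of_mem (a + b) (Finset.mem_range.mpr (Nat.lt_succ_of_le hdeg))]
  · rw [coeff_C_mul, coeff_add_monomial_pow,
      Finset.sum_eq_single_of_mem a (Finset.mem_range.mpr (by omega)), Nat.add_sub_cancel_left,
      coeff_monomial_same, one_mul, mul_assoc, ← map_natCast (algebraMap ℚ S), ← map_mul]
    · congr 2
      have h := Nat.add_choose_mul_factorial_mul_factorial a b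
      rw [← Nat.choose_symm_add] at h
      have h' : ((a + b).choose a : ℚ) * a.factorial * b.factorial = (a + b).factorial := by
        exact_mod_cast h
      have h1 := Nat.factorial_ne_zero a
      have h2 := Nat.factorial_ne_zero b
      have h3 := Nat.factorial_ne_zero (a + b)
      rw [← h']
      have h4 : (((a + b).choose a : ℕ) : ℚ) ≠ 0 := by
        exact_mod_cast (Nat.choose_pos (Nat.le_add_right a b)).ne'
      field_simp
    · intro i _ hi
      rw [coeff_monomial_ne, zero_mul]
      intro h
      exact hi (huniq _ _ h).1
  · intro d _ hd
    rw [coeff_C_mul, coeff_add_monomial_pow]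
    refine mul_eq_zero_of_right _ (Finset.sum_eq_zero fun i hi => ?_)
    rw [coeff_monomial_ne, zero_mul]
    intro h
    have := huniq _ _ h
    have := Finset.mem_range.mp hi
    omega

end

/-! ### Arithmetic of the resonance equation. -/

section Resonance

variable {p q r e l d m' σ A B : ℤ}

theorem resonance_of_parameter (hd : d ≠ 0) (hre : p * r = q * e + 1) (hm : d * m' = l + r + e)
    (hA : d * A = p * l + 1) (hB : d * B = q * l - 1) (t : ℤ) :
    (A * t - p) * r + (B * t - q) * (l + r) + 1 = m' * (t * l - d) * q ∧
      (A * t - p) * (l + e) + (B * t - q) * e - 1 = m' * (t * l - d) * p := by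
  constructor
  · apply mul_left_cancel₀ hd
    linear_combination r * t * hA + (l + r) * t * hB - (t * l - d) * q * hm + (t * l - d) * hre
  · apply mul_left_cancel₀ hd
    linear_combination (l + e) * t * hA + e * t * hB - (t * l - d) * p * hm - (t * l - d) * hre

/-- Adding the two equations compares total degrees: `(a+b) m' = κ σ`, so `m' ∣ κ` by coprimality.
What remains is `a l = A κ' + 1` with `κ = m' κ'`, which forces `κ' ≡ -d` modulo `l`. -/
theorem parameter_of_resonance (hd : d ≠ 0) (hl : l ≠ 0) (hσ0 : σ ≠ 0) (hm0 : m' ≠ 0)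
    (hre : p * r = q * e + 1) (hm : d * m' = l + r + e)
    (hσ : d * σ = p + q) (hcop : IsCoprime m' σ) (hA : d * A = p * l + 1)
    (hB : d * B = q * l - 1) {a b κ : ℤ} (h0 : a * r + b * (l + r) + 1 = κ * q)
    (h1 : a * (l + e) + b * e - 1 = κ * p) :
    ∃ t, a = A * t - p ∧ b = B * t - q ∧ κ = m' * (t * l - d) := by
  have hsum : (a + b) * m' = κ * σ := by
    apply mul_left_cancel₀ hd
    linear_combination h0 + h1 + (a + b) * hm - κ * hσ
  obtain ⟨κ', rfl⟩ : m' ∣ κ := hcop.dvd_of_dvd_mul_right (Dvd.intro_left _ hsum)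
  have hab : a + b = σ * κ' := by
    apply mul_right_cancel₀ hm0
    linear_combination hsum
  have hAB : A + B = σ * l := by
    apply mul_left_cancel₀ hd
    linear_combination hA + hB - l * hσ
  have ha : a * l = A * κ' + 1 := by
    apply mul_left_cancel₀ (mul_ne_zero hd hσ0)
    have hb : b = σ * κ' - a := by linear_combination hab
    subst hb
    linear_combination -a * d * hAB + a * hB - (σ * κ' - a) * hA - hσ - p * h0 + q * h1 +
      σ * κ' * hre
  obtain ⟨t, ht⟩ : l ∣ κ' + d := ⟨d * a - p * κ', by linear_combination -d * ha - κ' * hA⟩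
  obtain rfl : κ' = l * t - d := by linear_combination ht
  have ha' : a = A * t - p := by
    apply mul_right_cancel₀ hl
    linear_combination ha - hA
  refine ⟨t, ha', ?_, by ring⟩
  subst ha'
  linear_combination hab - t * hAB - hσ

end Resonance

/-! ### Melnikov numbers for two monomials. -/

section

variable {S : Type*} [CommRing S] [Algebra ℚ S] {p q r e l κ : ℕ}

theorem coeff_two_monomials_mul_expSeries_eq_zero (c₁ c₂ s : S)
    (h : ∀ a b : ℕ, a * r + b * (l + r) + 1 = κ * q →
      a * (l + e + 1) + b * (e + 1) = κ * p + 1 → False) :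
    coeff (resonantExp p q κ)
      ((monomial (bideg (r + 1) (l + e)) c₁ + monomial (bideg (l + r + 1) e) c₂) *
        expSeries (monomial (bideg r (l + e + 1)) 1 + monomial (bideg (l + r) (e + 1)) 1) s) =
      0 := by
  classical
  have hu : 0 < (bideg r (l + e + 1)).degree := by simp
  have hv : 0 < (bideg (l + r) (e + 1)).degree := by simp
  rw [add_mul, map_add, coeff_monomial_mul, coeff_monomial_mul]
  have h1 : ∀ w : Fin 2 →₀ ℕ, w ≤ resonantExp p q κ → ∀ a b : ℕ,
      resonantExp p q κ - w = a • bideg r (l + e + 1) + b • bideg (l + r) (e + 1) →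
      κ * q = w 0 + (a * r + b * (l + r)) ∧
        κ * p = w 1 + (a * (l + e + 1) + b * (e + 1)) := by
    intro w hw a b hab
    have hf : resonantExp p q κ = w + (a • bideg r (l + e + 1) + b • bideg (l + r) (e + 1)) := by
      rw [← hab, add_tsub_cancel_of_le hw]
    exact ⟨by simpa using DFunLike.congr_fun hf 0, by simpa using DFunLike.congr_fun hf 1⟩
  have z1 : bideg (r + 1) (l + e) ≤ resonantExp p q κ →
      coeff (resonantExp p q κ - bideg (r + 1) (l + e)) (expSeries (monomial
        (bideg r (l + e + 1)) 1 + monomial (bideg (l + r) (e + 1)) 1) s) = 0 := by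
    intro hw
    refine coeff_expSeries_eq_zero hu hv (fun a b hab => ?_) s
    obtain ⟨g0, g1⟩ := h1 _ hw a b hab
    simp only [bideg_zero_apply, bideg_one_apply] at g0 g1
    exact h (a + 1) b (by rw [g0]; ring) (by rw [g1]; ring)
  have z2 : bideg (l + r + 1) e ≤ resonantExp p q κ →
      coeff (resonantExp p q κ - bideg (l + r + 1) e) (expSeries (monomial
        (bideg r (l + e + 1)) 1 + monomial (bideg (l + r) (e + 1)) 1) s) = 0 := by
    intro hw
    refine coeff_expSeries_eq_zero hu hv (fun a b hab => ?_) s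
    obtain ⟨g0, g1⟩ := h1 _ hw a b hab
    simp only [bideg_zero_apply, bideg_one_apply] at g0 g1
    exact h a (b + 1) (by rw [g0]; ring) (by rw [g1]; ring)
  split_ifs with i1 i2 i2 <;> simp [*]

/-- The exponents `u` and `v` are linearly independent, so each monomial of `W` meets exactly one
term of the exponential. The result is a nonzero rational multiple of a power of `s` times a linear
form in `c₁, c₂`, which can be made to vanish. -/
theorem coeff_two_monomials_mul_expSeries (hl : 0 < l) (c₁ c₂ s : S) {a b : ℕ}
    (h0 : (a + 1) * r + (b + 1) * (l + r) + 1 = κ * q)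
    (h1 : (a + 1) * (l + e + 1) + (b + 1) * (e + 1) = κ * p + 1) :
    coeff (resonantExp p q κ)
      ((monomial (bideg (r + 1) (l + e)) c₁ + monomial (bideg (l + r + 1) e) c₂) *
        expSeries (monomial (bideg r (l + e + 1)) 1 + monomial (bideg (l + r) (e + 1)) 1) s) =
      s ^ (a + b + 1) * algebraMap ℚ S (1 / ((a + 1).factorial * (b + 1).factorial)) *
        (c₁ * (a + 1 : ℕ) + c₂ * (b + 1 : ℕ)) := by
  have hu : 0 < (bideg r (l + e + 1)).degree := by simp
  have hv : 0 < (bideg (l + r) (e + 1)).degree := by simp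
  have huniq : ∀ a b i j : ℕ, a • bideg r (l + e + 1) + b • bideg (l + r) (e + 1) =
      i • bideg r (l + e + 1) + j • bideg (l + r) (e + 1) → i = a ∧ j = b := by
    intro a b i j hij
    have g0 := DFunLike.congr_fun hij 0
    have g1 := DFunLike.congr_fun hij 1
    simp only [Finsupp.add_apply, Finsupp.smul_apply, bideg_zero_apply, bideg_one_apply,
      smul_eq_mul] at g0 g1
    have hsum : i + j = a + b := by
      apply Nat.eq_of_mul_eq_mul_right (show 0 < l + r + e + 1 by omega)
      linarith
    zify at g0 hsum ⊢
    have hj : (j : ℤ) = b := by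
      apply mul_right_cancel₀ (show (l : ℤ) ≠ 0 by omega)
      linear_combination -g0 - r * hsum
    exact ⟨by omega, hj⟩
  have e1 : resonantExp p q κ = bideg (r + 1) (l + e) +
      (a • bideg r (l + e + 1) + (b + 1) • bideg (l + r) (e + 1)) := by
    apply exponent_ext
    · simp only [resonantExp_zero_apply, Finsupp.add_apply, Finsupp.smul_apply, bideg_zero_apply,
        smul_eq_mul]
      linarith
    · simp only [resonantExp_one_apply, Finsupp.add_apply, Finsupp.smul_apply, bideg_one_apply,
        smul_eq_mul]
      linarith
  have e2 : resonantExp p q κ = bideg (l + r + 1) e +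
      ((a + 1) • bideg r (l + e + 1) + b • bideg (l + r) (e + 1)) := by
    apply exponent_ext
    · simp only [resonantExp_zero_apply, Finsupp.add_apply, Finsupp.smul_apply, bideg_zero_apply,
        smul_eq_mul]
      linarith
    · simp only [resonantExp_one_apply, Finsupp.add_apply, Finsupp.smul_apply, bideg_one_apply,
        smul_eq_mul]
      linarith
  rw [add_mul, map_add]
  nth_rewrite 1 [e1]
  rw [e2, coeff_add_monomial_mul, coeff_add_monomial_mul,
    coeff_expSeries_smul_add_smul hu hv (huniq _ _),
    coeff_expSeries_smul_add_smul hu hv (huniq _ _), ← map_natCast (algebraMap ℚ S),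
    ← map_natCast (algebraMap ℚ S)]
  have fa : (1 / (a.factorial * (b + 1).factorial) : ℚ) =
      1 / ((a + 1).factorial * (b + 1).factorial) * ((a + 1 : ℕ) : ℚ) := by
    have := Nat.factorial_ne_zero a
    have := Nat.factorial_ne_zero (b + 1)
    rw [Nat.factorial_succ a]
    push_cast
    field_simp
  have fb : (1 / ((a + 1).factorial * b.factorial) : ℚ) =
      1 / ((a + 1).factorial * (b + 1).factorial) * ((b + 1 : ℕ) : ℚ) := by
    have := Nat.factorial_ne_zero b
    have := Nat.factorial_ne_zero (a + 1)
    rw [Nat.factorial_succ b]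
    push_cast
    field_simp
  rw [fa, fb, map_mul, map_mul, ← add_assoc a b 1, add_right_comm a 1 b]
  ring

end

/-- With two suitable resonance exponents available, the perturbation can be chosen such that its
first nonzero Melnikov-type integral is the second one. -/
theorem exists_melnikov_coefficients {p q r e l d : ℕ} (hp : 0 < p) (hq : 0 < q)
    (hre : p * r = q * (e + 1) + 1)
    (hd : d = Nat.gcd (l + r + e + 1) (p + q)) (hl : (p + q) * (p + q + 1) ≤ l) :
    ∃ (k : ℕ) (γ₁ γ₂ ρ : ℤ), 1 ≤ k ∧ d * k = (l + r + e + 1) * (2 * l - d) ∧ ρ ≠ 0 ∧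
      ∀ (S : Type*) [CommRing S] [Algebra ℚ S],
      (∀ κ, 1 ≤ κ → κ < k → coeff (resonantExp p q κ)
        ((monomial (bideg (r + 1) (l + e)) (((r + 1 : ℕ) : S) * (γ₁ : S)) +
          monomial (bideg (l + r + 1) e) (((l + r + 1 : ℕ) : S) * (γ₂ : S))) *
        expSeries (monomial (bideg r (l + e + 1)) 1 + monomial (bideg (l + r) (e + 1)) 1)
          (-(κ : S))) = 0) ∧
      ∃ N : ℕ, N ≠ 0 ∧ (N : S) * coeff (resonantExp p q k)
        ((monomial (bideg (r + 1) (l + e)) (((r + 1 : ℕ) : S) * (γ₁ : S)) +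
          monomial (bideg (l + r + 1) e) (((l + r + 1 : ℕ) : S) * (γ₂ : S))) *
        expSeries (monomial (bideg r (l + e + 1)) 1 + monomial (bideg (l + r) (e + 1)) 1)
          (-(k : S))) = (ρ : S) := by
  have hd0 : 0 < d := hd ▸ Nat.gcd_pos_of_pos_left _ (by omega)
  obtain ⟨m', hm⟩ : d ∣ l + r + e + 1 := hd ▸ Nat.gcd_dvd_left _ _
  obtain ⟨σ, hσ⟩ : d ∣ p + q := hd ▸ Nat.gcd_dvd_right _ _
  have hcop : Nat.Coprime m' σ := by
    have : d * Nat.gcd m' σ = d * 1 := by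
      rw [← Nat.gcd_mul_left, ← hm, ← hσ, ← hd, mul_one]
    exact Nat.eq_of_mul_eq_mul_left hd0 this
  have hdle : d ≤ p + q := Nat.le_of_dvd (by omega) ⟨σ, hσ⟩
  have hm' : 0 < m' := Nat.pos_of_ne_zero (by rintro rfl; omega)
  have hσ' : 0 < σ := Nat.pos_of_ne_zero (by rintro rfl; omega)
  zify at hre hm hσ
  obtain ⟨A, hA⟩ : ∃ A : ℤ, (d : ℤ) * A = p * l + 1 :=
    ⟨p * m' - σ * (e + 1), by linear_combination -p * hm + (e + 1) * hσ + hre⟩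
  obtain ⟨B, hB⟩ : ∃ B : ℤ, (d : ℤ) * B = q * l - 1 :=
    ⟨q * m' - σ * r, by linear_combination -q * hm + r * hσ - hre⟩
  have hl0 : 0 < l := lt_of_lt_of_le (by positivity) hl
  have hlz : ((p : ℤ) + q) * (p + q + 1) ≤ l := by exact_mod_cast hl
  -- The lower bound on `l` makes `A - p` and `B - q` positive, so that `t = 1` already gives
  -- admissible exponents.
  have hAp : (p : ℤ) + 1 ≤ A := by
    by_contra hlt
    have h1 : (d : ℤ) * A ≤ d * p := mul_le_mul_of_nonneg_left (by omega) (by omega)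
    have h2 : (d : ℤ) * p ≤ (p + q) * p := mul_le_mul_of_nonneg_right (by omega) (by omega)
    have h3 : (1 : ℤ) * l ≤ p * l := mul_le_mul_of_nonneg_right (by omega) (by omega)
    have h4 : (0 : ℤ) ≤ (p + q) * (q + 1) := by positivity
    linarith
  have hBq : (q : ℤ) + 1 ≤ B := by
    by_contra hlt
    have h1 : (d : ℤ) * B ≤ d * q := mul_le_mul_of_nonneg_left (by omega) (by omega)
    have h2 : (d : ℤ) * q ≤ (p + q) * q := mul_le_mul_of_nonneg_right (by omega) (by omega)
    have h3 : (1 : ℤ) * l ≤ q * l := mul_le_mul_of_nonneg_right (by omega) (by omega)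
    have h4 : (0 : ℤ) ≤ (p + q) * p := by positivity
    have h5 : (2 : ℤ) ≤ p + q := by omega
    linarith
  have hpar := resonance_of_parameter (p := p) (q := q) (r := r) (e := e + 1) (l := l) (d := d)
    (m' := m') (A := A) (B := B) (by omega) (by linear_combination hre) (by linear_combination -hm)
    hA hB
  have hdl : d ≤ l := hdle.trans ((Nat.le_mul_of_pos_right _ (by omega)).trans hl)
  obtain ⟨a₁, ha₁⟩ : ∃ a₁ : ℕ, A - p = a₁ + 1 := ⟨(A - p - 1).toNat, by omega⟩
  obtain ⟨b₁, hb₁⟩ : ∃ b₁ : ℕ, B - q = b₁ + 1 := ⟨(B - q - 1).toNat, by omega⟩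
  obtain ⟨a₂, ha₂⟩ : ∃ a₂ : ℕ, A * 2 - p = a₂ + 1 := ⟨(A * 2 - p - 1).toNat, by omega⟩
  obtain ⟨b₂, hb₂⟩ : ∃ b₂ : ℕ, B * 2 - q = b₂ + 1 := ⟨(B * 2 - q - 1).toNat, by omega⟩
  have hk2 : (((m' * (2 * l - d) : ℕ)) : ℤ) = m' * (2 * l - d) := by
    push_cast [Nat.cast_sub (show d ≤ 2 * l by omega)]; ring
  have hk : 1 ≤ m' * (2 * l - d) := Nat.mul_pos hm' (by omega)
  set k := m' * (2 * l - d) with hkdef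
  set c : ℤ := (r + 1) * (l + r + 1) with hc
  set δ : ℤ := (b₁ + 1) * (a₂ + 1) - (a₁ + 1) * (b₂ + 1) with hδ
  -- `δ = p B - q A`, and `d δ = -(p + q)`.
  have hδ0 : δ ≠ 0 := by
    intro h0
    rw [hδ, ← ha₁, ← ha₂, ← hb₁, ← hb₂] at h0
    have : (d : ℤ) * (p * B - q * A) = 0 := by linear_combination d * h0
    have h2 : (p : ℤ) + q = 0 := by linear_combination -this + p * hB - q * hA
    omega
  -- The coefficients annihilate the linear form attached to `t = 1`; at `t = 2` that form takes the
  -- value `c δ`.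
  refine ⟨k, (l + r + 1) * (b₁ + 1), -((r + 1) * (a₁ + 1)),
    (-(k : ℤ)) ^ (a₂ + b₂ + 1) * (c * δ), hk, ?_, ?_, ?_⟩
  · zify [show d ≤ 2 * l by omega]
    rw [hk2]
    linear_combination -(2 * (l : ℤ) - d) * hm
  · refine mul_ne_zero (pow_ne_zero _ (by omega)) (mul_ne_zero ?_ hδ0)
    positivity
  intro S _ _
  refine ⟨fun κ hκ hκk => ?_, (a₂ + 1).factorial * (b₂ + 1).factorial,
    mul_ne_zero (Nat.factorial_ne_zero _) (Nat.factorial_ne_zero _), ?_⟩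
  · by_cases hex : ∃ a b : ℕ, a * r + b * (l + r) + 1 = κ * q ∧
        a * (l + e + 1) + b * (e + 1) = κ * p + 1
    · obtain ⟨a, b, h0, h1⟩ := hex
      have h0z : (a : ℤ) * r + b * (l + r) + 1 = κ * q := by exact_mod_cast h0
      have h1z : (a : ℤ) * (l + e + 1) + b * (e + 1) = κ * p + 1 := by exact_mod_cast h1
      obtain ⟨t, hta, htb, htκ⟩ := parameter_of_resonance (p := p) (q := q) (r := r)
        (e := e + 1) (l := l) (d := d) (m' := m') (σ := σ) (A := A) (B := B) (a := a) (b := b)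
        (κ := κ) (by omega) (by omega) (by omega) (by omega) (by linear_combination hre)
        (by linear_combination -hm) hσ.symm (Nat.isCoprime_iff_coprime.mpr hcop) hA hB h0z
        (by linear_combination h1z)
      -- For `t ≤ 0` the exponent `a = A t - p` would be negative.
      have ht1 : 0 < t := by
        by_contra hneg
        have := mul_nonneg (show 0 ≤ A by omega) (show 0 ≤ -t by omega)
        rw [mul_neg] at this
        omega
      have ht2 : t < 2 := by
        by_contra hge
        have : (k : ℤ) ≤ κ := by
          rw [hk2, htκ]
          have : (2 : ℤ) * l ≤ t * l := mul_le_mul_of_nonneg_right (by omega) (by omega)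
          exact mul_le_mul_of_nonneg_left (by linarith) (by omega)
        omega
      obtain rfl : t = 1 := by omega
      obtain rfl : a = a₁ + 1 := by omega
      obtain rfl : b = b₁ + 1 := by omega
      rw [coeff_two_monomials_mul_expSeries hl0 _ _ _ h0 h1]
      push_cast
      ring
    · exact coeff_two_monomials_mul_expSeries_eq_zero _ _ _
        fun a b h0 h1 => hex ⟨a, b, h0, h1⟩
  · obtain ⟨g0, g1⟩ := hpar 2
    rw [ha₂, hb₂, ← hk2] at g0 g1
    rw [coeff_two_monomials_mul_expSeries (a := a₂) (b := b₂) hl0 _ _ _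
      (by zify; exact g0) (by zify; linear_combination g1)]
    have hfac : (((a₂ + 1).factorial * (b₂ + 1).factorial : ℕ) : S) *
        algebraMap ℚ S (1 / ((a₂ + 1).factorial * (b₂ + 1).factorial)) = 1 := by
      rw [← map_natCast (algebraMap ℚ S), ← map_mul, ← map_one (algebraMap ℚ S)]
      congr 1
      have := Nat.factorial_ne_zero (a₂ + 1)
      have := Nat.factorial_ne_zero (b₂ + 1)
      push_cast
      field_simp
    rw [mul_assoc, mul_left_comm, ← mul_assoc _ (algebraMap ℚ S _), hfac, one_mul, hc, hδ]
    push_cast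
    ring

/-! ### Change of coefficients, and the perturbed system as a homogeneous one. -/

section

variable {R S : Type*} [CommRing R] [CommRing S]

theorem map_pderiv (φ : R →+* S) (i : Fin 2) (F : MvPowerSeries (Fin 2) R) :
    map φ (pderiv R i F) = pderiv S i (map φ F) := by
  ext e
  simp [coeff_pderiv]

theorem map_form (φ : R →+* S) (n : ℕ) (a : Fin (n + 1) → R) :
    map φ (form n a) = form n (fun i => φ (a i)) := by
  simp [form, x, y]

theorem map_derivAlong (φ : R →+* S) (p q : ℕ) (P Q H : MvPowerSeries (Fin 2) R) :
    map φ (derivAlong p q P Q H) = derivAlong p q (map φ P) (map φ Q) (map φ H) := by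
  simp [derivAlong, map_pderiv, x, y]

theorem HasResonantLeadingTerm.map {p q : ℕ} {H : MvPowerSeries (Fin 2) R}
    (hH : HasResonantLeadingTerm p q H) (φ : R →+* S) :
    HasResonantLeadingTerm p q (MvPowerSeries.map φ H) :=
  ⟨by rw [coeff_map, hH.1, map_one], fun m hm hne => by rw [coeff_map, hH.2 m hm hne, map_zero]⟩

theorem IsResonantSeries.map {p q : ℕ} {L : ℕ → R} {F : MvPowerSeries (Fin 2) R}
    (hF : IsResonantSeries p q L F) (φ : R →+* S) :
    IsResonantSeries p q (fun k => φ (L k)) (MvPowerSeries.map φ F) :=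
  ⟨fun k hk => by rw [coeff_map, hF.1 k hk], fun m hm => by rw [coeff_map, hF.2 m hm, map_zero]⟩

theorem form_add (n : ℕ) (a b : Fin (n + 1) → S) : form n (a + b) = form n a + form n b := by
  simp [form, add_mul, Finset.sum_add_distrib]

theorem form_single (n : ℕ) (j : Fin (n + 1)) (c : S) :
    form n (Pi.single j c) = C c * (x ^ (n - (j : ℕ)) * y ^ (j : ℕ)) := by
  rw [form, Finset.sum_eq_single j]
  · rw [Pi.single_eq_same, mul_assoc]
  · intro i _ hi
    rw [Pi.single_eq_of_ne hi]
    simp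
  · simp

theorem derivAlong_eq_hamField (p q : ℕ) (Φ V H : MvPowerSeries (Fin 2) S) :
    derivAlong p q (x * logDeriv 1 Φ + x * V) (-(y * logDeriv 0 Φ)) H =
      hamField p q Φ H + V * logDeriv 0 H := by
  rw [derivAlong, hamField, logDeriv_apply 0 H, logDeriv_apply 1 H, x, y]
  ring

theorem logDeriv_x_pow_mul_y_pow (k : Fin 2) (i j : ℕ) :
    logDeriv k (x ^ i * y ^ j : MvPowerSeries (Fin 2) S) =
      C ((bideg i j k : ℕ) : S) * (x ^ i * y ^ j) := by
  rw [x_pow_mul_y_pow, logDeriv_monomial, map_natCast]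

/-- Coefficients of the first component of the perturbed Hamiltonian system. -/
noncomputable def perturbedCoeffX (l r e : ℕ) (a b : S) : Fin (l + r + e + 2 + 1) → S :=
  Pi.single ⟨l + e + 1, by omega⟩ ((l + e + 1 : ℕ) : S) +
    Pi.single ⟨e + 1, by omega⟩ ((e + 1 : ℕ) : S) +
    (Pi.single ⟨l + e, by omega⟩ a + Pi.single ⟨e, by omega⟩ b)

/-- Coefficients of the second component of the perturbed Hamiltonian system. -/
noncomputable def perturbedCoeffY (S : Type*) [CommRing S] (l r e : ℕ) :
    Fin (l + r + e + 2 + 1) → S :=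
  Pi.single ⟨l + e + 2, by omega⟩ (-(r : S)) + Pi.single ⟨e + 2, by omega⟩ (-((l + r : ℕ) : S))

theorem form_perturbedCoeffX (l r e : ℕ) (a b : S) :
    form (l + r + e + 2) (perturbedCoeffX l r e a b) =
      x * logDeriv 1 (monomial (bideg r (l + e + 1)) 1 + monomial (bideg (l + r) (e + 1)) 1) +
        x * (monomial (bideg (r + 1) (l + e)) a + monomial (bideg (l + r + 1) e) b) := by
  have hm : ∀ (i j : ℕ) (c : S), monomial (bideg i j) c = C c * (x ^ i * y ^ j) := by
    intro i j c
    rw [x_pow_mul_y_pow, ← smul_eq_C_mul, ← map_smul, smul_eq_mul, mul_one]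
  rw [perturbedCoeffX, form_add, form_add, form_add, form_single, form_single, form_single,
    form_single, ← x_pow_mul_y_pow, ← x_pow_mul_y_pow, map_add, logDeriv_x_pow_mul_y_pow,
    logDeriv_x_pow_mul_y_pow, hm, hm]
  have h1 : l + r + e + 2 - (l + e + 1) = r + 1 := by omega
  have h2 : l + r + e + 2 - (e + 1) = l + r + 1 := by omega
  have h3 : l + r + e + 2 - (l + e) = r + 1 + 1 := by omega
  have h4 : l + r + e + 2 - e = l + r + 1 + 1 := by omega
  simp only [h1, h2, h3, h4, bideg_one_apply]
  ring

theorem form_perturbedCoeffY (l r e : ℕ) :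
    form (l + r + e + 2) (perturbedCoeffY S l r e) =
      -(y * logDeriv 0 (monomial (bideg r (l + e + 1)) 1 +
        monomial (bideg (l + r) (e + 1)) 1)) := by
  rw [perturbedCoeffY, form_add, form_single, form_single, ← x_pow_mul_y_pow, ← x_pow_mul_y_pow,
    map_add, logDeriv_x_pow_mul_y_pow, logDeriv_x_pow_mul_y_pow]
  have h1 : l + r + e + 2 - (l + e + 2) = r := by omega
  have h2 : l + r + e + 2 - (e + 2) = l + r := by omega
  simp only [h1, h2, bideg_zero_apply, map_neg]
  ring

end

/-- Infinitely near a Hamiltonian system there is a system whose first nonzero saddle value has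
index `k`, hence the universal saddle value `L k` is not in the ideal of the preceding ones. -/
theorem exists_notMem_saddleIdeal (𝕜 : Type*) [Field 𝕜] [CharZero 𝕜] {p q r e l d : ℕ}
    (hp : 0 < p) (hq : 0 < q) (hpq : Nat.Coprime p q) (hre : p * r = q * (e + 1) + 1)
    (hd : d = Nat.gcd (l + r + e + 1) (p + q)) (hl : (p + q) * (p + q + 1) ≤ l)
    {L : ℕ → CoeffRing 𝕜 (l + r + e + 2)} (hL : IsSaddleValues 𝕜 p q (l + r + e + 2) L) :
    ∃ k, 1 ≤ k ∧ L k ∉ saddleIdeal L (k - 1) ∧ d * k = (l + r + e + 1) * (2 * l - d) := by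
  obtain ⟨k, γ₁, γ₂, ρ, hk, hdk, hρ, hmel⟩ := exists_melnikov_coefficients hp hq hre hd hl
  refine ⟨k, hk, ?_, hdk⟩
  obtain ⟨H, hH, hHL⟩ := hL
  set ε : DualNumber 𝕜 := DualNumber.eps with hε
  set φ : CoeffRing 𝕜 (l + r + e + 2) →+* DualNumber 𝕜 := (MvPolynomial.aeval (Sum.elim
    (perturbedCoeffX l r e (ε * γ₁) (ε * γ₂)) (perturbedCoeffY (DualNumber 𝕜) l r e))).toRingHom
    with hφ
  obtain ⟨hvan, N, hN, hval⟩ := hmel (DualNumber 𝕜)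
  set Φ : MvPowerSeries (Fin 2) (DualNumber 𝕜) :=
    monomial (bideg r (l + e + 1)) 1 + monomial (bideg (l + r) (e + 1)) 1 with hΦdef
  set W : MvPowerSeries (Fin 2) (DualNumber 𝕜) :=
    monomial (bideg (r + 1) (l + e)) (γ₁ : DualNumber 𝕜) +
    monomial (bideg (l + r + 1) e) (γ₂ : DualNumber 𝕜) with hWdef
  have hlog : logDeriv 0 W = monomial (bideg (r + 1) (l + e)) (((r + 1 : ℕ) : DualNumber 𝕜) * γ₁) +
      monomial (bideg (l + r + 1) e) (((l + r + 1 : ℕ) : DualNumber 𝕜) * γ₂) := by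
    rw [hWdef, map_add, logDeriv_monomial, logDeriv_monomial, bideg_zero_apply, bideg_zero_apply,
      ← nsmul_eq_mul, ← nsmul_eq_mul, ← map_nsmul, ← map_nsmul, nsmul_eq_mul, nsmul_eq_mul]
  have hεW : monomial (bideg (r + 1) (l + e)) (ε * γ₁) + monomial (bideg (l + r + 1) e) (ε * γ₂) =
      C ε * W := by
    rw [hWdef, mul_add, ← smul_eq_C_mul, ← smul_eq_C_mul, ← map_smul, ← map_smul, smul_eq_mul,
      smul_eq_mul]
  have hseries := hHL.map φ
  have hX : ∀ s, φ (MvPolynomial.X s) = Sum.elim (perturbedCoeffX l r e (ε * γ₁) (ε * γ₂))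
      (perturbedCoeffY (DualNumber 𝕜) l r e) s := fun s => MvPolynomial.aeval_X _ s
  rw [map_derivAlong, map_form, map_form] at hseries
  simp only [hX, Sum.elim_inl, Sum.elim_inr] at hseries
  rw [form_perturbedCoeffX, form_perturbedCoeffY, hεW, derivAlong_eq_hamField, mul_assoc] at hseries
  have hΦ0 : constantCoeff Φ = 0 := by
    rw [hΦdef, map_add, constantCoeff_monomial (by simp), constantCoeff_monomial (by simp),
      add_zero]
  have hW0 : constantCoeff W = 0 := by
    rw [hWdef, map_add, constantCoeff_monomial (by simp),
      constantCoeff_monomial (by simp),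
      add_zero]
  obtain ⟨hzero, hlast⟩ := saddleValue_of_perturbation hp hpq hΦ0 hW0 DualNumber.eps_mul_eps
    (hH.map φ) hseries hk (by rw [hlog]; exact hvan)
  intro hmem
  -- The specialised `L 1, …, L (k-1)` vanish; membership of `L k` would give `ρ ε = 0` with `ρ` a
  -- nonzero integer.
  have hle : saddleIdeal L (k - 1) ≤ RingHom.ker φ := by
    rw [saddleIdeal, Ideal.span_le]
    rintro _ ⟨j, hj, rfl⟩
    exact hzero j hj.1 (by have := hj.2; omega)
  have h0 : φ (L k) = 0 := hle hmem
  rw [h0, mul_zero, hlog] at hlast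
  have h1 : (ρ : DualNumber 𝕜) * ε = 0 := by
    rw [← hval, mul_assoc, mul_comm _ ε, ← hlast, mul_zero]
  have h2 := congrArg TrivSqZeroExt.snd (eq_zero_of_intCast_mul_eq_zero hρ h1)
  simp [hε] at h2

/-! ### Existence of saddle values. -/

section Existence

variable {R : Type*} [CommRing R]

theorem le_order_mul_pderiv {P F : MvPowerSeries (Fin 2) R} (hP : 2 ≤ P.order) (i : Fin 2) {t : ℕ}
    (hF : (t : ℕ∞) ≤ F.order) : ((t + 1 : ℕ) : ℕ∞) ≤ (P * pderiv R i F).order := by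
  have h1 : ((t - 1 : ℕ) : ℕ∞) ≤ (pderiv R i F).order := by
    refine nat_le_order fun e he => ?_
    rw [coeff_pderiv, coeff_of_lt_order, zero_mul]
    refine lt_of_lt_of_le ?_ hF
    rw [map_add, Finsupp.degree_single]
    exact_mod_cast (by omega : e.degree + 1 < t)
  refine le_trans ?_ ((add_le_add hP h1).trans le_order_mul)
  exact_mod_cast (by omega : t + 1 ≤ 2 + (t - 1))

theorem le_order_form (n : ℕ) (a : Fin (n + 1) → R) : (n : ℕ∞) ≤ (form n a).order := by
  refine nat_le_order fun e he => ?_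
  rw [form, map_sum]
  refine Finset.sum_eq_zero fun i _ => ?_
  rw [mul_assoc, x_pow_mul_y_pow, coeff_C_mul, coeff_monomial_ne, mul_zero]
  rintro rfl
  have := i.2
  rw [degree_bideg] at he
  omega

/-- The nonlinear part of the derivative along the vector field. -/
noncomputable def nonlinearPart (P Q F : MvPowerSeries (Fin 2) R) : MvPowerSeries (Fin 2) R :=
  P * pderiv R 0 F + Q * pderiv R 1 F

theorem nonlinearPart_sub (P Q F G : MvPowerSeries (Fin 2) R) :
    nonlinearPart P Q (F - G) = nonlinearPart P Q F - nonlinearPart P Q G := by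
  simp only [nonlinearPart, map_sub]
  ring

theorem le_order_nonlinearPart {P Q F : MvPowerSeries (Fin 2) R} (hP : 2 ≤ P.order)
    (hQ : 2 ≤ Q.order) {t : ℕ} (hF : (t : ℕ∞) ≤ F.order) :
    ((t + 1 : ℕ) : ℕ∞) ≤ (nonlinearPart P Q F).order :=
  (le_min (le_order_mul_pderiv hP 0 hF) (le_order_mul_pderiv hQ 1 hF)).trans min_order_le_add

theorem coeff_derivAlong (p q : ℕ) (P Q F : MvPowerSeries (Fin 2) R) (e : Fin 2 →₀ ℕ) :
    coeff e (derivAlong p q P Q F) =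
      ((p : R) * e 0 - q * e 1) * coeff e F + coeff e (nonlinearPart P Q F) := by
  have h : derivAlong p q P Q F =
      C (p : R) * logDeriv 0 F - C (q : R) * logDeriv 1 F + nonlinearPart P Q F := by
    rw [derivAlong, nonlinearPart, logDeriv_apply, logDeriv_apply, x, y, map_natCast, map_natCast]
    ring
  rw [h, map_add, map_sub, coeff_C_mul, coeff_C_mul, coeff_logDeriv, coeff_logDeriv]
  ring

variable [Algebra ℚ R]

/-- The map whose fixed points are the series `x ^ q * y ^ p + h.o.t.` with derivative a series in
`x ^ q * y ^ p`. -/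
noncomputable def integralStep (p q : ℕ) (P Q F : MvPowerSeries (Fin 2) R) :
    MvPowerSeries (Fin 2) R := fun e =>
  if e = resonantExp p q 1 then 1
  -- At the other resonant exponents the inverse is that of `0`, which is `0`; this normalises those
  -- coefficients of the fixed point to zero.
  else -(algebraMap ℚ R (((p : ℚ) * e 0 - q * e 1)⁻¹) * coeff e (nonlinearPart P Q F))

theorem coeff_integralStep (p q : ℕ) (P Q F : MvPowerSeries (Fin 2) R) (e : Fin 2 →₀ ℕ) :
    coeff e (integralStep p q P Q F) = if e = resonantExp p q 1 then 1
      else -(algebraMap ℚ R (((p : ℚ) * e 0 - q * e 1)⁻¹) * coeff e (nonlinearPart P Q F)) := rfl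

theorem le_order_integralStep_sub (p q : ℕ) {P Q F G : MvPowerSeries (Fin 2) R}
    (hP : 2 ≤ P.order) (hQ : 2 ≤ Q.order) {t : ℕ} (h : (t : ℕ∞) ≤ (F - G).order) :
    ((t + 1 : ℕ) : ℕ∞) ≤ (integralStep p q P Q F - integralStep p q P Q G).order := by
  refine nat_le_order fun e he => ?_
  have h1 := coeff_of_lt_order (lt_of_lt_of_le (by exact_mod_cast he)
    (le_order_nonlinearPart hP hQ h))
  rw [nonlinearPart_sub, map_sub, sub_eq_zero] at h1
  rw [map_sub, coeff_integralStep, coeff_integralStep, h1, sub_self]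

/-- The step gains one degree of agreement, so its iterates from `0` converge coefficientwise:
coefficients of degree `D` are stable from iterate `D + 1` on. -/
theorem exists_integralStep_eq_self (p q : ℕ) {P Q : MvPowerSeries (Fin 2) R}
    (hP : 2 ≤ P.order) (hQ : 2 ≤ Q.order) : ∃ F, integralStep p q P Q F = F := by
  set T := integralStep p q P Q with hT
  have hagree : ∀ t j : ℕ, (t : ℕ∞) ≤ (T^[t + j] 0 - T^[t] 0).order := by
    intro t j
    induction t with
    | zero => simp
    | succ t ih =>
      rw [show t + 1 + j = (t + j) + 1 by ring, Function.iterate_succ_apply',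
        Function.iterate_succ_apply']
      exact le_order_integralStep_sub p q hP hQ ih
  let F : MvPowerSeries (Fin 2) R := fun e => coeff e (T^[e.degree + 1] 0)
  have hF : ∀ e, coeff e F = coeff e (T^[e.degree + 1] 0) := fun _ => rfl
  have happrox : ∀ t : ℕ, (t : ℕ∞) ≤ (F - T^[t] 0).order := by
    intro t
    refine nat_le_order fun e he => ?_
    have h := coeff_of_lt_order (lt_of_lt_of_le (by exact_mod_cast Nat.lt_succ_self e.degree)
      (hagree (e.degree + 1) (t - (e.degree + 1))))
    rw [Nat.add_sub_cancel' he, map_sub, sub_eq_zero] at h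
    rw [map_sub, hF, h, sub_self]
  refine ⟨F, ?_⟩
  ext e
  have h := coeff_of_lt_order (lt_of_lt_of_le (by exact_mod_cast Nat.lt_succ_self e.degree)
    (le_order_integralStep_sub p q hP hQ (happrox e.degree)))
  rw [← hT, ← Function.iterate_succ_apply' T, map_sub, sub_eq_zero] at h
  rw [h, hF]

theorem exists_isResonantSeries_derivAlong {p q : ℕ} (hp : 0 < p) (hpq : Nat.Coprime p q)
    {P Q : MvPowerSeries (Fin 2) R} (hP : 2 ≤ P.order) (hQ : 2 ≤ Q.order) :
    ∃ (L : ℕ → R) (H : MvPowerSeries (Fin 2) R), HasResonantLeadingTerm p q H ∧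
      IsResonantSeries p q L (derivAlong p q P Q H) := by
  obtain ⟨H, hH⟩ := exists_integralStep_eq_self p q hP hQ
  have hcoeff : ∀ e, coeff e H = if e = resonantExp p q 1 then 1
      else -(algebraMap ℚ R (((p : ℚ) * e 0 - q * e 1)⁻¹) * coeff e (nonlinearPart P Q H)) := by
    intro e
    conv_lhs => rw [← hH]
    rw [coeff_integralStep]
  have hord : ∀ t ≤ p + q, (t : ℕ∞) ≤ H.order := by
    intro t
    induction t with
    | zero => simp
    | succ t ih =>
      intro ht
      refine nat_le_order fun e he => ?_
      rw [hcoeff, if_neg, coeff_of_lt_order, mul_zero, neg_zero]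
      · exact lt_of_lt_of_le (by exact_mod_cast he) (le_order_nonlinearPart hP hQ (ih (by omega)))
      · rintro rfl
        rw [degree_resonantExp] at he
        omega
  have hlow : ∀ e : Fin 2 →₀ ℕ, e.degree ≤ p + q → coeff e (nonlinearPart P Q H) = 0 :=
    fun e he => coeff_of_lt_order (lt_of_lt_of_le (by exact_mod_cast Nat.lt_succ_of_le he)
      (le_order_nonlinearPart hP hQ (hord _ le_rfl)))
  refine ⟨fun k => coeff (resonantExp p q (k + 1)) (nonlinearPart P Q H), H,
    ⟨by rw [hcoeff, if_pos rfl], fun e he hne => by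
      rw [hcoeff, if_neg hne, hlow e he, mul_zero, neg_zero]⟩, fun k _ => ?_, fun e he => ?_⟩
  · rw [coeff_derivAlong, resonantExp_zero_apply, resonantExp_one_apply]
    push_cast
    ring
  · rw [coeff_derivAlong]
    by_cases hres : p * e 0 = q * e 1
    · obtain ⟨k, rfl⟩ := exists_eq_resonantExp hp hpq hres
      have hk : k ≤ 1 := by
        by_contra hk
        exact he (k - 1) (by omega) (by rw [Nat.sub_add_cancel (by omega)])
      rw [hlow, resonantExp_zero_apply, resonantExp_one_apply]
      · push_cast
        ring
      · rw [degree_resonantExp]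
        exact (Nat.mul_le_mul_right _ hk).trans (one_mul _).le
    · have hne : e ≠ resonantExp p q 1 := by
        rintro rfl
        apply hres
        rw [resonantExp_zero_apply, resonantExp_one_apply]
        ring
      have hne0 : (p : ℚ) * e 0 - q * e 1 ≠ 0 := by
        rw [sub_ne_zero]
        exact_mod_cast hres
      have hinv : ((p : R) * e 0 - q * e 1) *
          algebraMap ℚ R (((p : ℚ) * e 0 - q * e 1)⁻¹) = 1 := by
        have := congrArg (algebraMap ℚ R) (mul_inv_cancel₀ hne0)
        simpa only [map_mul, map_sub, map_natCast, map_one] using this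
      rw [hcoeff e, if_neg hne, mul_neg, ← mul_assoc, hinv, one_mul, neg_add_cancel]

end Existence

theorem exists_isSaddleValues (𝕜 : Type*) [Field 𝕜] [CharZero 𝕜] {p q n : ℕ} (hp : 0 < p)
    (hpq : Nat.Coprime p q) (hn : 2 ≤ n) : ∃ L, IsSaddleValues 𝕜 p q n L := by
  have h : ∀ a : Fin (n + 1) → CoeffRing 𝕜 n, 2 ≤ (form n a).order := fun a =>
    le_trans (by exact_mod_cast hn) (le_order_form n a)
  exact exists_isResonantSeries_derivAlong hp hpq (h _) (h _)

/-! ### The ascending chain of ideals. -/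

section IdealChain

variable {R : Type*} [CommRing R] (L : ℕ → R)

theorem saddleIdeal_mono : Monotone (saddleIdeal L) := fun _ _ h =>
  Ideal.span_mono (Set.image_mono (Set.Icc_subset_Icc_right h))

theorem saddleIdeal_le_top (k : ℕ) : saddleIdeal L k ≤ saddleIdealTop L :=
  Ideal.span_mono (Set.image_mono fun _ h => h.1)

theorem mem_saddleIdeal {j k : ℕ} (hj : 1 ≤ j) (hjk : j ≤ k) : L j ∈ saddleIdeal L k :=
  Ideal.subset_span ⟨j, ⟨hj, hjk⟩, rfl⟩

theorem mem_saddleIdealTop {j : ℕ} (hj : 1 ≤ j) : L j ∈ saddleIdealTop L :=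
  Ideal.subset_span ⟨j, hj, rfl⟩

theorem saddleIdeal_idealOrder [IsNoetherianRing R] :
    saddleIdeal L (idealOrder L) = saddleIdealTop L := by
  refine Nat.sInf_mem (s := {M : ℕ | saddleIdeal L M = saddleIdealTop L}) ?_
  obtain ⟨M, hM⟩ := monotone_stabilizes_iff_noetherian.mpr ‹IsNoetherianRing R›
    ⟨saddleIdeal L, saddleIdeal_mono L⟩
  refine ⟨M, (saddleIdeal_le_top L M).antisymm ?_⟩
  rw [saddleIdealTop, Ideal.span_le]
  rintro _ ⟨j, hj, rfl⟩
  have h : saddleIdeal L M = saddleIdeal L (max M j) := hM _ (le_max_left M j)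
  rw [h]
  exact mem_saddleIdeal L hj (le_max_right M j)

theorem isGreatest_idealOrder [IsNoetherianRing R]
    (h : ∃ k, 1 ≤ k ∧ L k ∉ saddleIdeal L (k - 1)) :
    IsGreatest {k : ℕ | 1 ≤ k ∧ L k ∉ saddleIdeal L (k - 1)} (idealOrder L) := by
  have hub : ∀ k, 1 ≤ k ∧ L k ∉ saddleIdeal L (k - 1) → k ≤ idealOrder L := by
    rintro k ⟨hk, hmem⟩
    by_contra hlt
    apply hmem
    apply saddleIdeal_mono L (show idealOrder L ≤ k - 1 by omega)
    rw [saddleIdeal_idealOrder]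
    exact mem_saddleIdealTop L hk
  -- Positivity ensures that `idealOrder L - 1` is a strictly smaller candidate, contradicting
  -- minimality below.
  have hpos : 1 ≤ idealOrder L := by
    obtain ⟨k, hk⟩ := h
    exact hk.1.trans (hub k hk)
  refine ⟨⟨hpos, fun hmem => ?_⟩, hub⟩
  have hle : saddleIdealTop L ≤ saddleIdeal L (idealOrder L - 1) := by
    rw [← saddleIdeal_idealOrder, saddleIdeal, Ideal.span_le]
    rintro _ ⟨j, hj, rfl⟩
    rcases hj.2.lt_or_eq with hlt | rfl
    · exact mem_saddleIdeal L hj.1 (by omega)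
    · exact hmem
  have : idealOrder L ≤ idealOrder L - 1 :=
    Nat.sInf_le ((saddleIdeal_le_top L _).antisymm hle)
  omega

end IdealChain

/-! ### Choice of `r` and `e`, the quadratic estimate and the conclusion. -/

theorem exists_mul_eq_mul_succ_add_one {p q : ℕ} (hp : 0 < p) (hq : 0 < q)
    (hpq : Nat.Coprime p q) : ∃ r e : ℕ, p * r = q * (e + 1) + 1 := by
  obtain ⟨u, v, huv⟩ := Nat.isCoprime_iff_coprime.mpr hpq
  have hq' : (|u| + |v| + 1) ≤ q * (|u| + |v| + 1) :=
    le_mul_of_one_le_left (by positivity) (by omega)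
  have hp' : (|u| + |v| + 1) ≤ p * (|u| + |v| + 1) :=
    le_mul_of_one_le_left (by positivity) (by omega)
  have hu := neg_abs_le u
  have hv := le_abs_self v
  have hu0 := abs_nonneg u
  have hv0 := abs_nonneg v
  -- A Bézout pair, shifted along `(q, -p)` until the signs are right.
  obtain ⟨r, hr⟩ := Int.eq_ofNat_of_zero_le (show 0 ≤ u + q * (|u| + |v| + 1) by linarith)
  obtain ⟨e, he⟩ := Int.eq_ofNat_of_zero_le (show 0 ≤ -v + p * (|u| + |v| + 1) - 1 by linarith)
  refine ⟨r, e, ?_⟩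
  zify
  rw [← hr, ← he]
  linear_combination huv

theorem quadratic_le_of_mul_eq {l c d k : ℕ} (hd : 1 ≤ d)
    (h : d * k = (l + c + 1) * (2 * l - d)) :
    2 / (d : ℝ) * ((l + c + 2 : ℕ) : ℝ) ^ 2 - (2 * c + 7) * ((l + c + 2 : ℕ) : ℝ) ≤ k := by
  have hd' : (1 : ℝ) ≤ d := by exact_mod_cast hd
  have hsub : (2 * l : ℝ) - d ≤ ((2 * l - d : ℕ) : ℝ) := by
    have : 2 * l ≤ (2 * l - d) + d := by omega
    have : (2 * l : ℝ) ≤ ((2 * l - d : ℕ) : ℝ) + d := by exact_mod_cast this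
    linarith
  have hk : (l + c + 1 : ℝ) * (2 * l - d) ≤ d * k := by
    have : (d : ℝ) * k = (l + c + 1) * ((2 * l - d : ℕ) : ℝ) := by exact_mod_cast h
    rw [this]
    gcongr
  have hexp : 2 / (d : ℝ) * ((l + c + 2 : ℕ) : ℝ) ^ 2 - (2 * c + 7) * ((l + c + 2 : ℕ) : ℝ) =
      (2 * (l + c + 2 : ℝ) ^ 2 - d * ((2 * c + 7) * (l + c + 2))) / d := by
    push_cast
    field_simp
  rw [hexp, div_le_iff₀ (by linarith), mul_comm (k : ℝ)]
  refine le_trans ?_ hk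
  have h1 : 0 ≤ ((d : ℝ) - 1) * ((2 * c + 6) * (l + c + 2)) :=
    mul_nonneg (by linarith) (by positivity)
  have hl : (0 : ℝ) ≤ l := by positivity
  have hc : (0 : ℝ) ≤ c := by positivity
  nlinarith [mul_nonneg hl hc]

end ResonantSaddle

theorem theorem3 (𝕜 : Type*) [RCLike 𝕜] (p q : ℕ) (hp : 0 < p) (hq : 0 < q)
    (hpq : Nat.Coprime p q) :
    ∃ (C : ℝ) (n₀ : ℕ), ∀ n : ℕ, n₀ ≤ n →
      (∃ L : ℕ → ResonantSaddle.CoeffRing 𝕜 n, ResonantSaddle.IsSaddleValues 𝕜 p q n L) ∧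
      ∀ L : ℕ → ResonantSaddle.CoeffRing 𝕜 n, ResonantSaddle.IsSaddleValues 𝕜 p q n L →
        ResonantSaddle.saddleIdeal L (ResonantSaddle.idealOrder L) =
          ResonantSaddle.saddleIdealTop L ∧
        IsGreatest {k : ℕ | 1 ≤ k ∧ L k ∉ ResonantSaddle.saddleIdeal L (k - 1)}
          (ResonantSaddle.idealOrder L) ∧
        3 / (2 * (Nat.gcd (n - 1) (p + q) : ℝ)) * (n : ℝ) ^ 2 - C * (n : ℝ) ≤
          (ResonantSaddle.idealOrder L : ℝ) ∧
        (p = 1 →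
          2 / (Nat.gcd (n - 1) (p + q) : ℝ) * (n : ℝ) ^ 2 - C * (n : ℝ) ≤
            (ResonantSaddle.idealOrder L : ℝ)) := by
  obtain ⟨r, e, hre⟩ := ResonantSaddle.exists_mul_eq_mul_succ_add_one hp hq hpq
  refine ⟨2 * ((r + e : ℕ) : ℝ) + 7, (p + q) * (p + q + 1) + (r + e + 2), fun n hn => ?_⟩
  refine ⟨ResonantSaddle.exists_isSaddleValues 𝕜 hp hpq (by omega), fun L hL => ?_⟩
  obtain ⟨l, rfl⟩ : ∃ l, n = l + r + e + 2 := ⟨n - (r + e + 2), by omega⟩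
  obtain ⟨k, hk, hmem, hdk⟩ := ResonantSaddle.exists_notMem_saddleIdeal 𝕜 hp hq hpq hre rfl
    (show (p + q) * (p + q + 1) ≤ l by omega) hL
  have hgreatest := ResonantSaddle.isGreatest_idealOrder L ⟨k, hk, hmem⟩
  rw [show l + r + e + 2 - 1 = l + r + e + 1 by omega]
  set d := Nat.gcd (l + r + e + 1) (p + q) with hd
  have hd1 : 1 ≤ d := Nat.gcd_pos_of_pos_left _ (by omega)
  have hbound := ResonantSaddle.quadratic_le_of_mul_eq (c := r + e) hd1
    (by rw [hdk]; ring_nf : d * k = (l + (r + e) + 1) * (2 * l - d))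
  rw [← add_assoc l r e] at hbound
  have hkM : (k : ℝ) ≤ ResonantSaddle.idealOrder L := by exact_mod_cast hgreatest.2 ⟨hk, hmem⟩
  refine ⟨ResonantSaddle.saddleIdeal_idealOrder L, hgreatest, ?_, fun _ => hbound.trans hkM⟩
  refine le_trans ?_ (hbound.trans hkM)
  have hd' : (1 : ℝ) ≤ d := by exact_mod_cast hd1
  -- The construction gives the constant `2/d` for every `p`; the bound with `3/(2d)` is a
  -- weakening.
  have : 3 / (2 * (d : ℝ)) ≤ 2 / d := by
    rw [div_le_div_iff₀ (by linarith) (by linarith)]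
    linarith
  gcongr
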